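/- **Setting.** Let $N>2$, let $\Omega\subset\mathbb R^N$ be a bounded domain (open, connected, non-empty) with Lipschitz boundary, and let $\vec p=(p_1,\dots,p_N)$ with $p_i>1$. Put $p_i'=\frac{p_i}{p_i-1}$, $\frac1{\bar p}=\frac1N\sum_{i=1}^N\frac1{p_i}$, assume $\bar p<N$, and put $\bar p^*=\frac{N\bar p}{N-\bar p}$, $p_\infty=\max\{\bar p^*,\max_i p_i\}$. For $q>1$, $L^{q,\infty}(\Omega)$ denotes the Marcinkiewicz space of measurable $f$ on $\Omega$ with $\sup_{t>0}t^{q}\,|\{x\in\Omega:|f(x)|>t\}|<\infty$. Let $W^{1,\vec p}(\Omega)=\{u\in W^{1,1}(\Omega):\partial_{x_i}u\in L^{p_i}(\Omega),\ i=1,\dots,N\}$ with norm $\|u\|_{L^1}+\sum_i\|\partial_{x_i}u\|_{L^{p_i}}$, and let $W_0^{1,\vec p}(\Omega)$ be the closure of $C_0^\infty(\Omega)$ in it. Consider the problem $$-\sum_{i=1}^N\partial_{x_i}\big[\mathcal A_i(x,\nabla u)+\mathcal B_i(x,u)\big]+\mathcal G(x,u)=\mathcal F\ \text{ in }\Omega,\qquad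 u=0\ \text{ on }\partial\Omega, \tag{P}$$ under the following assumptions, for every $i=1,\dots,N$, for a.e. $x\in\Omega$, all $\xi,\eta\in\mathbb R^N$ and all $s\in\mathbb R$: * $\mathcal A_i:\Omega\times\mathbb R^N\to\mathbb R$ is a Carathéodory function with $|\mathcal A_i(x,\xi)|\le\beta_i|\xi_i|^{p_i-1}$, $\alpha|\xi_i|^{p_i}\le\mathcal A_i(x,\xi)\,\xi_i$, and $(\mathcal A_i(x,\xi)-\mathcal A_i(x,\eta))(\xi_i-\eta_i)>0$ whenever $\xi_i\ne\eta_i$, where $0<\alpha\le\beta_i$ are constants; * $\mathcal B_i:\Omega\times\mathbb R\to\mathbb R$ is a Carathéodory function with $|\mathcal B_i(x,s)|\le b_i(x)|s|^{\bar p/p_i'}$, where $b_i:\Omega\to[0,\infty)$ belongs to $L^{Np_i'/\bar p,\infty}(\Omega)$; * $\mathcal G:\Omega\times\mathbb R\to\mathbb R$ is a Carathéodory function with $|\mathcal G(x,s)|\le\tilde\mu|s|^\gamma$ and $\mathcal G(x,s)\,s\ge0$, where $\tilde\mu\ge0$ and $1\le\gamma<p_\infty-1$ are constants; * $\mathcal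 F$ belongs to the dual space $(W_0^{1,\vec p}(\Omega))^*$. A weak solution of (P) is a function $u\in W_0^{1,\vec p}(\Omega)$ such that for all $\varphi\in C_0^\infty(\Omega)$ $$\int_\Omega\Big(\sum_{i=1}^N\big[\mathcal A_i(x,\nabla u)+\mathcal B_i(x,u)\big]\partial_{x_i}\varphi+\mathcal G(x,u)\,\varphi\Big)dx=\langle\mathcal F,\varphi\rangle .$$ **Theorem 6.1.** In addition, let $p_i\le2$ for all $i$ and $2\min_i\frac{\bar p}{p_i'}\ge1$. Suppose that $\mathcal G\not\equiv0$ and that $s\mapsto\mathcal G(x,s)$ is strictly increasing for a.e. $x\in\Omega$; that there is a constant $\tilde\alpha>0$ such that, for every $i$, a.e. $x\in\Omega$ and all $\xi,\xi'\in\mathbb R^N$, $$(\mathcal A_i(x,\xi)-\mathcal A_i(x,\xi'))(\xi_i-\xi_i')\ \ge\ \tilde\alpha\,(|\xi_i|+|\xi_i'|)^{p_i-2}|\xi_i-\xi_i'|^2$$ (the right-hand side being read as $0$ when $\xi_i=\xi_i'=0$); and that, for every $i$, a.e. $x\in\Omega$ and all $s,s'\in\mathbb R$, $$|\mathcal B_i(x,s)-\mathcal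 B_i(x,s')|\le\tilde b_i(x)\,|s-s'|^{\bar p/p_i'}$$ with $\tilde b_i:\Omega\to[0,\infty)$ in $L^{Np_i'/\bar p,\infty}(\Omega)$. If $u\in W_0^{1,\vec p}(\Omega)$ is a weak solution of (P), then it is the unique one: every weak solution $v\in W_0^{1,\vec p}(\Omega)$ of (P) equals $u$. -/

import Mathlib

open MeasureTheory TopologicalSpace Set
open scoped Distributions ContDiff

noncomputable section

namespace AnisotropicElliptic

/-! ### Exponents, domains, Marcinkiewicz spaces -/

/-- Vectors `(p₁, …, p_N)` of real exponents `p_i > 1`. -/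
abbrev Exponents (N : ℕ) : Type := Fin N → Set.Ioi (1 : ℝ)

instance factOneLeOfReal (q : Set.Ioi (1 : ℝ)) : Fact (1 ≤ ENNReal.ofReal (q : ℝ)) :=
  ⟨ENNReal.one_le_ofReal.2 (le_of_lt q.2)⟩

/-- The harmonic mean `p̄`, i.e. `1 / p̄ = (1 / N) ∑ i, 1 / p_i`. -/
def pbar {N : ℕ} (p : Exponents N) : ℝ := ((1 / (N : ℝ)) * ∑ i, 1 / (p i : ℝ))⁻¹

/-- The conjugate exponent `p_i' = p_i / (p_i - 1)`. -/
def pconj {N : ℕ} (p : Exponents N) (i : Fin N) : ℝ := Real.conjExponent (p i : ℝ)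

/-- `p_∞ = max {p̄*, max_i p_i}` with `p̄* = N p̄ / (N - p̄)`. -/
def pinfty {N : ℕ} (p : Exponents N) : ℝ :=
  max ((N : ℝ) * pbar p / ((N : ℝ) - pbar p)) (⨆ i, (p i : ℝ))

/-- `Ω` has Lipschitz boundary: near each boundary point, in suitable orthonormal coordinates,
`Ω` is the strict epigraph of a Lipschitz function. Here `e` is the "vertical" unit vector,
`⟪e, y⟫` the vertical coordinate of `y`, and `y - ⟪e, y⟫ e` its horizontal part. -/
def HasLipschitzBoundary {N : ℕ} (Ω : Opens (EuclideanSpace ℝ (Fin N))) : Prop :=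
  ∀ x₀ ∈ frontier (Ω : Set (EuclideanSpace ℝ (Fin N))),
    ∃ r : ℝ, 0 < r ∧ ∃ e : EuclideanSpace ℝ (Fin N), ‖e‖ = 1 ∧
      ∃ (K : NNReal) (h : EuclideanSpace ℝ (Fin N) → ℝ), LipschitzWith K h ∧
        ∀ y ∈ Metric.ball x₀ r, y ∈ Ω ↔ h (y - inner ℝ e y • e) < inner ℝ e y

/-- The Marcinkiewicz (weak Lebesgue) space `L^{q,∞}(μ)`: measurable functions with
`sup_{t > 0} t ^ q * μ {|f| > t} < ∞`. -/
def MemMarcinkiewicz {X : Type*} [MeasurableSpace X] (f : X → ℝ) (q : ℝ) (μ : Measure X) : Prop :=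
  AEMeasurable f μ ∧
    (⨆ t : Set.Ioi (0 : ℝ), ENNReal.ofReal ((t : ℝ) ^ q) * μ {x | (t : ℝ) < |f x|}) < ⊤

/-- Carathéodory functions on `Ω`: measurable in `x` for every value of the second variable,
continuous in the second variable for almost every `x`. -/
def IsCaratheodory {N : ℕ} {Y : Type*} [TopologicalSpace Y]
    (Ω : Opens (EuclideanSpace ℝ (Fin N))) (f : EuclideanSpace ℝ (Fin N) → Y → ℝ) : Prop :=
  (∀ y, AEMeasurable (fun x => f x y) (volume.restrict Ω)) ∧
    ∀ᵐ x ∂(volume.restrict (Ω : Set (EuclideanSpace ℝ (Fin N)))), Continuous (f x)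

/-! ### Anisotropic Sobolev spaces -/

/-- The classical partial derivative `∂φ/∂x_i`. -/
def partialDeriv {N : ℕ} (i : Fin N) (φ : EuclideanSpace ℝ (Fin N) → ℝ)
    (x : EuclideanSpace ℝ (Fin N)) : ℝ :=
  fderiv ℝ φ x (EuclideanSpace.single i 1)

/-- `g` is the weak partial derivative of `u` in direction `x_i` on `Ω` (both functions being
integrable on `Ω` wherever this is used). -/
def IsWeakPartial {N : ℕ} (Ω : Opens (EuclideanSpace ℝ (Fin N))) (i : Fin N)
    (u g : EuclideanSpace ℝ (Fin N) → ℝ) : Prop :=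
  ∀ φ : 𝓓(Ω, ℝ), ∫ x in Ω, u x * partialDeriv i φ x = - ∫ x in Ω, g x * φ x

/-- `L¹(Ω) × ∏ i, L^{p_i}(Ω)`, the space of pairs (function, candidate gradient). -/
abbrev PairSpace {N : ℕ} (Ω : Opens (EuclideanSpace ℝ (Fin N))) (p : Exponents N) : Type :=
  Lp ℝ 1 (volume.restrict (Ω : Set (EuclideanSpace ℝ (Fin N)))) ×
    ∀ i, Lp ℝ (ENNReal.ofReal (p i : ℝ)) (volume.restrict (Ω : Set (EuclideanSpace ℝ (Fin N))))

section Aux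

variable {N : ℕ} {Ω : Opens (EuclideanSpace ℝ (Fin N))}

theorem continuous_partialDeriv (i : Fin N) (φ : 𝓓(Ω, ℝ)) : Continuous (partialDeriv i φ) :=
  (φ.contDiff.continuous_fderiv (by simp)).clm_apply continuous_const

theorem hasCompactSupport_partialDeriv (i : Fin N) (φ : 𝓓(Ω, ℝ)) :
    HasCompactSupport (partialDeriv i φ) :=
  φ.hasCompactSupport.fderiv_apply ℝ _

theorem memLp_testFunction (q : ENNReal) (φ : 𝓓(Ω, ℝ)) : MemLp φ q (volume.restrict Ω) :=
  (φ.continuous.memLp_of_hasCompactSupport φ.hasCompactSupport (μ := volume)).restrict _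

theorem memLp_partialDeriv (q : ENNReal) (i : Fin N) (φ : 𝓓(Ω, ℝ)) :
    MemLp (partialDeriv i φ) q (volume.restrict Ω) :=
  ((continuous_partialDeriv i φ).memLp_of_hasCompactSupport
    (hasCompactSupport_partialDeriv i φ) (μ := volume)).restrict _

theorem integrable_mul_testFunction {q : ENNReal} (hq : 1 ≤ q)
    {u : EuclideanSpace ℝ (Fin N) → ℝ} (hu : MemLp u q (volume.restrict Ω))
    {ψ : EuclideanSpace ℝ (Fin N) → ℝ} (hψ : Continuous ψ) (hψc : HasCompactSupport ψ) :
    Integrable (fun x => u x * ψ x) (volume.restrict Ω) := by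
  have hq' : ENNReal.HolderConjugate q (ENNReal.conjExponent q) := .conjExponent hq
  have := hq'
  exact MemLp.integrable_mul (p := q) (q := ENNReal.conjExponent q) hu
    ((hψ.memLp_of_hasCompactSupport hψc (μ := volume)).restrict _)

theorem setIntegral_eq_of_tsupport_subset {f : EuclideanSpace ℝ (Fin N) → ℝ}
    (hf : tsupport f ⊆ Ω) : ∫ x in Ω, f x = ∫ x, f x :=
  setIntegral_eq_integral_of_forall_compl_eq_zero fun x hx => by
    by_contra h
    exact hx (hf (subset_tsupport _ h))

theorem isWeakPartial_testFunction (i : Fin N) (φ : 𝓓(Ω, ℝ)) :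
    IsWeakPartial Ω i φ (partialDeriv i φ) := by
  intro ψ
  rw [setIntegral_eq_of_tsupport_subset, setIntegral_eq_of_tsupport_subset]
  · have hφ : Differentiable ℝ φ := φ.contDiff.differentiable (by simp)
    have hψ : Differentiable ℝ ψ := ψ.contDiff.differentiable (by simp)
    refine integral_mul_fderiv_eq_neg_fderiv_mul_of_integrable ?_ ?_ ?_ (fun x _ => hφ x)
      (fun x _ => hψ x)
    · exact ((continuous_partialDeriv i φ).mul ψ.continuous).integrable_of_hasCompactSupport
        (hasCompactSupport_partialDeriv i φ).mul_right
    · exact (φ.continuous.mul (continuous_partialDeriv i ψ)).integrable_of_hasCompactSupport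
        φ.hasCompactSupport.mul_right
    · exact (φ.continuous.mul ψ.continuous).integrable_of_hasCompactSupport
        φ.hasCompactSupport.mul_right
  · exact (tsupport_mul_subset_right).trans ψ.tsupport_subset
  · exact (tsupport_mul_subset_left).trans φ.tsupport_subset

end Aux

/-- The anisotropic Sobolev space `W^{1,p}(Ω)`: functions `u ∈ L¹(Ω)` with weak partial derivatives
`∂_i u ∈ L^{p_i}(Ω)`, stored as pairs `(u, ∇u)` (the weak gradient is determined by `u`; on a bounded
`Ω` it automatically lies in `L¹`). The norm inherited from the product is
`max {‖u‖₁, max_i ‖∂_i u‖_{p_i}}`, which is equivalent to `‖u‖₁ + ∑ i, ‖∂_i u‖_{p_i}`. -/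
def W1 {N : ℕ} (Ω : Opens (EuclideanSpace ℝ (Fin N))) (p : Exponents N) :
    Submodule ℝ (PairSpace Ω p) where
  carrier := {w | ∀ i, IsWeakPartial Ω i w.1 (w.2 i)}
  zero_mem' := by
    intro i φ
    have h1 : ∫ x in Ω, (0 : PairSpace Ω p).1 x * partialDeriv i φ x = 0 := by
      refine integral_eq_zero_of_ae ?_
      filter_upwards [Lp.coeFn_zero ℝ 1
        (volume.restrict (Ω : Set (EuclideanSpace ℝ (Fin N))))] with x hx
      exact mul_eq_zero_of_left hx _
    have h2 : ∫ x in Ω, (0 : PairSpace Ω p).2 i x * φ x = 0 := by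
      refine integral_eq_zero_of_ae ?_
      filter_upwards [Lp.coeFn_zero ℝ (ENNReal.ofReal (p i : ℝ))
        (volume.restrict (Ω : Set (EuclideanSpace ℝ (Fin N))))] with x hx
      exact mul_eq_zero_of_left hx _
    rw [h1, h2, neg_zero]
  add_mem' := by
    intro v w hv hw i φ
    have h1 : ∫ x in Ω, (v + w).1 x * partialDeriv i φ x =
        (∫ x in Ω, v.1 x * partialDeriv i φ x) + ∫ x in Ω, w.1 x * partialDeriv i φ x := by
      rw [← integral_add (integrable_mul_testFunction le_rfl (Lp.memLp v.1)
          (continuous_partialDeriv i φ) (hasCompactSupport_partialDeriv i φ))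
        (integrable_mul_testFunction le_rfl (Lp.memLp w.1)
          (continuous_partialDeriv i φ) (hasCompactSupport_partialDeriv i φ))]
      refine integral_congr_ae ?_
      filter_upwards [Lp.coeFn_add v.1 w.1] with x hx
      exact (congrArg (· * partialDeriv i φ x) hx).trans (add_mul _ _ _)
    have h2 : ∫ x in Ω, (v + w).2 i x * φ x =
        (∫ x in Ω, v.2 i x * φ x) + ∫ x in Ω, w.2 i x * φ x := by
      rw [← integral_add (integrable_mul_testFunction (factOneLeOfReal (p i)).out
          (Lp.memLp (v.2 i)) φ.continuous φ.hasCompactSupport)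
        (integrable_mul_testFunction (factOneLeOfReal (p i)).out
          (Lp.memLp (w.2 i)) φ.continuous φ.hasCompactSupport)]
      refine integral_congr_ae ?_
      filter_upwards [Lp.coeFn_add (v.2 i) (w.2 i)] with x hx
      exact (congrArg (· * φ x) hx).trans (add_mul _ _ _)
    rw [h1, h2, hv i φ, hw i φ]
    ring
  smul_mem' := by
    intro c w hw i φ
    have h1 : ∫ x in Ω, (c • w).1 x * partialDeriv i φ x =
        c * ∫ x in Ω, w.1 x * partialDeriv i φ x := by
      rw [← integral_const_mul]
      refine integral_congr_ae ?_
      filter_upwards [Lp.coeFn_smul c w.1] with x hx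
      exact (congrArg (· * partialDeriv i φ x) hx).trans (mul_assoc _ _ _)
    have h2 : ∫ x in Ω, (c • w).2 i x * φ x = c * ∫ x in Ω, w.2 i x * φ x := by
      rw [← integral_const_mul]
      refine integral_congr_ae ?_
      filter_upwards [Lp.coeFn_smul c (w.2 i)] with x hx
      exact (congrArg (· * φ x) hx).trans (mul_assoc _ _ _)
    rw [h1, h2, hw i φ]
    ring

/-- A test function `φ ∈ C₀^∞(Ω)` as an element of `W^{1,p}(Ω)`. -/
def testW1 {N : ℕ} (Ω : Opens (EuclideanSpace ℝ (Fin N))) (p : Exponents N) (φ : 𝓓(Ω, ℝ)) :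
    W1 Ω p :=
  ⟨((memLp_testFunction 1 φ).toLp φ,
      fun i => (memLp_partialDeriv (ENNReal.ofReal (p i : ℝ)) i φ).toLp (partialDeriv i φ)), by
    intro i ψ
    have h1 := (memLp_testFunction 1 φ).coeFn_toLp
    have h2 := (memLp_partialDeriv (ENNReal.ofReal (p i : ℝ)) i φ).coeFn_toLp
    refine Eq.trans (integral_congr_ae ?_)
      ((isWeakPartial_testFunction i φ ψ).trans (congrArg Neg.neg (integral_congr_ae ?_)))
    · filter_upwards [h1] with x hx
      simp [hx]
    · filter_upwards [h2] with x hx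
      simp [hx]⟩

/-- `W_0^{1,p}(Ω)`: the closure of (the linear space) `C₀^∞(Ω)` in `W^{1,p}(Ω)`. On bounded `Ω` the
norm of `W^{1,p}(Ω)` is equivalent to `∑ i, ‖∂_i u‖_{p_i}` on `C₀^∞(Ω)` by the Poincaré inequality,
so this is also the closure with respect to the latter norm, with the same topological dual. -/
def W0 {N : ℕ} (Ω : Opens (EuclideanSpace ℝ (Fin N))) (p : Exponents N) :
    Submodule ℝ (W1 Ω p) :=
  (Submodule.span ℝ (Set.range (testW1 Ω p))).topologicalClosure

/-- A test function as an element of `W_0^{1,p}(Ω)`. -/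
def testW0 {N : ℕ} (Ω : Opens (EuclideanSpace ℝ (Fin N))) (p : Exponents N) (φ : 𝓓(Ω, ℝ)) :
    W0 Ω p :=
  ⟨testW1 Ω p φ, Submodule.le_topologicalClosure _ (Submodule.subset_span ⟨φ, rfl⟩)⟩

/-- The values of `u ∈ W_0^{1,p}(Ω)` (a representative, meaningful a.e. in `Ω`). -/
def val {N : ℕ} {Ω : Opens (EuclideanSpace ℝ (Fin N))} {p : Exponents N} (u : W0 Ω p) :
    EuclideanSpace ℝ (Fin N) → ℝ :=
  u.1.1.1

/-- The weak gradient of `u ∈ W_0^{1,p}(Ω)` (a representative, meaningful a.e. in `Ω`). -/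
def grad {N : ℕ} {Ω : Opens (EuclideanSpace ℝ (Fin N))} {p : Exponents N} (u : W0 Ω p) :
    EuclideanSpace ℝ (Fin N) → Fin N → ℝ :=
  fun x i => u.1.1.2 i x

/-! ### The structural assumptions and weak solutions -/

/-- Assumption on the principal part `𝒜_i`: Carathéodory, growth, coercivity, and strict
monotonicity in `ξ_i`. -/
structure PrincipalAssumption {N : ℕ} (Ω : Opens (EuclideanSpace ℝ (Fin N))) (p : Exponents N)
    (α : ℝ) (β : Fin N → ℝ)
    (A : Fin N → EuclideanSpace ℝ (Fin N) → (Fin N → ℝ) → ℝ) : Prop where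
  α_pos : 0 < α
  α_le : ∀ i, α ≤ β i
  caratheodory : ∀ i, IsCaratheodory Ω (A i)
  growth : ∀ i, ∀ᵐ x ∂(volume.restrict (Ω : Set (EuclideanSpace ℝ (Fin N)))), ∀ ξ : Fin N → ℝ,
    |A i x ξ| ≤ β i * |ξ i| ^ ((p i : ℝ) - 1)
  coercive : ∀ i, ∀ᵐ x ∂(volume.restrict (Ω : Set (EuclideanSpace ℝ (Fin N)))), ∀ ξ : Fin N → ℝ,
    α * |ξ i| ^ (p i : ℝ) ≤ A i x ξ * ξ i
  monotone : ∀ i, ∀ᵐ x ∂(volume.restrict (Ω : Set (EuclideanSpace ℝ (Fin N)))),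
    ∀ ξ η : Fin N → ℝ, ξ i ≠ η i → 0 < (A i x ξ - A i x η) * (ξ i - η i)

/-- Assumption on the convection terms `ℬ_i`: Carathéodory with
`|ℬ_i(x,s)| ≤ b_i(x) |s|^{p̄/p_i'}`, where `0 ≤ b_i ∈ L^{N p_i'/p̄,∞}(Ω)`. -/
structure ConvectionAssumption {N : ℕ} (Ω : Opens (EuclideanSpace ℝ (Fin N))) (p : Exponents N)
    (b : Fin N → EuclideanSpace ℝ (Fin N) → ℝ)
    (B : Fin N → EuclideanSpace ℝ (Fin N) → ℝ → ℝ) : Prop where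
  caratheodory : ∀ i, IsCaratheodory Ω (B i)
  b_nonneg : ∀ i, ∀ x ∈ Ω, 0 ≤ b i x
  b_mem : ∀ i, MemMarcinkiewicz (b i) (N * pconj p i / pbar p)
    (volume.restrict (Ω : Set (EuclideanSpace ℝ (Fin N))))
  growth : ∀ i, ∀ᵐ x ∂(volume.restrict (Ω : Set (EuclideanSpace ℝ (Fin N)))), ∀ s : ℝ,
    |B i x s| ≤ b i x * |s| ^ (pbar p / pconj p i)

/-- Assumption on the zero order term `𝒢`: Carathéodory, growth with exponent
`1 ≤ γ < p_∞ - 1`, and the sign condition. -/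
structure ZeroOrderAssumption {N : ℕ} (Ω : Opens (EuclideanSpace ℝ (Fin N))) (p : Exponents N)
    (μ γ : ℝ) (G : EuclideanSpace ℝ (Fin N) → ℝ → ℝ) : Prop where
  μ_nonneg : 0 ≤ μ
  one_le_γ : 1 ≤ γ
  γ_lt : γ < pinfty p - 1
  caratheodory : IsCaratheodory Ω G
  growth : ∀ᵐ x ∂(volume.restrict (Ω : Set (EuclideanSpace ℝ (Fin N)))), ∀ s : ℝ,
    |G x s| ≤ μ * |s| ^ γ
  sign : ∀ᵐ x ∂(volume.restrict (Ω : Set (EuclideanSpace ℝ (Fin N)))), ∀ s : ℝ, 0 ≤ G x s * s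

/-- `u ∈ W_0^{1,p}(Ω)` is a weak solution of
`-∑ i, ∂_i [𝒜_i(x,∇u) + ℬ_i(x,u)] + 𝒢(x,u) = ℱ` in `Ω`, `u = 0` on `∂Ω`,
where `ℱ` is in the dual of `W_0^{1,p}(Ω)`. -/
def IsWeakSolution {N : ℕ} {Ω : Opens (EuclideanSpace ℝ (Fin N))} {p : Exponents N}
    (A : Fin N → EuclideanSpace ℝ (Fin N) → (Fin N → ℝ) → ℝ)
    (B : Fin N → EuclideanSpace ℝ (Fin N) → ℝ → ℝ)
    (G : EuclideanSpace ℝ (Fin N) → ℝ → ℝ)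
    (F : StrongDual ℝ (W0 Ω p)) (u : W0 Ω p) : Prop :=
  ∀ φ : 𝓓(Ω, ℝ),
    ∫ x in Ω, ((∑ i, (A i x (grad u x) + B i x (val u x)) * partialDeriv i φ x) +
      G x (val u x) * φ x) = F (testW0 Ω p φ)

end AnisotropicElliptic

end

/-!
Let `w = u - v`. Subtracting the two weak formulations and testing with `arctan (w / ε)` gives

`∑ i, ∫ k_ε(w) [𝒜_i(∇u) - 𝒜_i(∇v) + ℬ_i(u) - ℬ_i(v)] ∂_i w + ∫ (𝒢(u) - 𝒢(v)) arctan (w / ε) = 0`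

with `k_ε(s) = ε / (ε² + s²)`. By strong monotonicity and Young's inequality the square bracket
times `∂_i w` is at least `-(4 α')⁻¹ |w| ^ (2 p̄ / p_i') W_i`, where
`W_i = b'_i² (|∂_i u| + |∂_i v|) ^ (2 - p_i)` is integrable because `b'_i ∈ L^{p_i'}`. As
`1 ≤ 2 p̄ / p_i' ≤ 2`, the factor `k_ε(w) |w| ^ (2 p̄ / p_i')` is bounded by `1` and tends to `0`
pointwise as `ε → 0`. Dominated convergence yields `∫ (𝒢(u) - 𝒢(v)) arctan w ≤ 0` (`integral_mul_arctan_le`,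
`mul_arctan_val_ae_eq_zero`), and `w = 0` since `𝒢` is strictly increasing.

The analytic input is that the flux differences lie in `L^{p_i'}` and `𝒢(u)` in `L¹`, so that the
identity, known for smooth test functions, extends to `arctan (w / ε)` (`integral_comp_eq_zero`).
For the convection terms this is the critical case of an anisotropic Sobolev embedding with a
Marcinkiewicz weight: `∫ b_i ^ p_i' |u| ^ p̄ < ∞` for `b_i ^ p_i' ∈ L^{N / p̄, ∞}`
(`memLp_weight_mul_rpow_val`). It is proved by truncation. The grid-lines lemma of Mathlib, applied
to a weighted sum of the partial derivatives of a cutoff of `φ` between the heights `2 ^ k` and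
`2 ^ (k + 1)`, bounds `|{|φ| > 2 ^ (k + 1)}|` by the energy between these heights plus a multiple of
`|{|φ| > 2 ^ k}|` (`level_inequality`). Choosing the weight well, the volume term is absorbed, and
summation over `k` bounds `∑ k, 2 ^ (k p̄) |{|φ| > 2 ^ k}| ^ (1 - p̄ / N)`
(`exists_tsum_level_le`), a Lorentz-type quantity which controls both integrals; Fatou's lemma
passes from test functions to `W_0^{1,p}(Ω)`.
-/

noncomputable section

namespace AnisotropicElliptic

/-! ### Marcinkiewicz functions and dyadic level sets -/

/-- Dyadic layer-cake bound. -/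
theorem lintegral_rpow_abs_le {X : Type*} [MeasurableSpace X] {ν : Measure X} {f : X → ℝ}
    (hf : AEMeasurable f ν) {r : ℝ} (hr : 0 ≤ r) :
    ∫⁻ x, ENNReal.ofReal (|f x| ^ r) ∂ν ≤ ν univ +
      ∑' k : ℕ, ENNReal.ofReal ((2 ^ (k + 1) : ℝ) ^ r) * ν {x | (2 : ℝ) ^ k < |f x|} := by
  have hm : ∀ k : ℕ, NullMeasurableSet {x | (2 : ℝ) ^ k < |f x|} ν := fun k =>
    nullMeasurableSet_lt aemeasurable_const hf.abs
  have hterm : ∀ k : ℕ, AEMeasurable ({x | (2 : ℝ) ^ k < |f x|}.indicator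
      fun _ => ENNReal.ofReal ((2 ^ (k + 1) : ℝ) ^ r)) ν := fun k =>
    aemeasurable_const.indicator₀ (hm k)
  calc ∫⁻ x, ENNReal.ofReal (|f x| ^ r) ∂ν
      ≤ ∫⁻ x, (1 + ∑' k : ℕ, {x | (2 : ℝ) ^ k < |f x|}.indicator
          (fun _ => ENNReal.ofReal ((2 ^ (k + 1) : ℝ) ^ r)) x) ∂ν := by
        refine lintegral_mono fun x => ?_
        by_cases h : |f x| ≤ 1
        · refine le_trans ?_ le_self_add
          exact ENNReal.ofReal_le_one.2 (Real.rpow_le_one (abs_nonneg _) h hr)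
        · push Not at h
          obtain ⟨n, hn1, hn2⟩ := exists_mem_Ioc_zpow (zero_lt_one.trans h)
            (one_lt_two : (1 : ℝ) < 2)
          have hn : 0 ≤ n := by
            by_contra! hn
            exact absurd (hn2.trans (zpow_le_one_of_nonpos₀ one_le_two (by lia))) (not_le.2 h)
          lift n to ℕ using hn
          have hn1' : (2 : ℝ) ^ n < |f x| := by exact_mod_cast hn1
          have hn2' : |f x| ≤ (2 : ℝ) ^ (n + 1) := by exact_mod_cast hn2
          refine le_trans ?_ le_add_self
          refine le_trans ?_ (ENNReal.le_tsum n)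
          rw [indicator_of_mem (by exact hn1')]
          exact ENNReal.ofReal_le_ofReal (Real.rpow_le_rpow (abs_nonneg _) hn2' hr)
    _ = _ := by
        rw [lintegral_add_left measurable_const, lintegral_tsum hterm]
        congr 1
        · simp
        · exact tsum_congr fun k => lintegral_indicator_const₀ (hm k) _

/-- If `f ∈ L^{sq,∞}`, then `∫_E |f| ^ s` is at most a multiple of `ν(E) ^ (1 - 1 / q)`:
Hölder's inequality between a weak Lebesgue function and an indicator. -/
theorem MemMarcinkiewicz.exists_setLIntegral_le {X : Type*} [MeasurableSpace X] {ν : Measure X}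
    [IsFiniteMeasure ν] {f : X → ℝ} {s q : ℝ} (hs : 0 < s) (hq : 1 < q)
    (hf : MemMarcinkiewicz f (s * q) ν) :
    ∃ C : NNReal, ∀ E : Set X, MeasurableSet E →
      ∫⁻ x in E, ENNReal.ofReal (|f x| ^ s) ∂ν ≤ C * ν E ^ (1 - 1 / q) := by
  obtain ⟨hfm, hfM⟩ := hf
  set M : ENNReal := ⨆ t : Set.Ioi (0 : ℝ),
    ENNReal.ofReal ((t : ℝ) ^ (s * q)) * ν {x | (t : ℝ) < |f x|}
  have hM : ∀ t : ℝ, 0 < t → ν {x | t < |f x|} ≤ M * ENNReal.ofReal (t ^ (-(s * q))) := by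
    intro t ht
    have h1 : ENNReal.ofReal (t ^ (s * q)) * ν {x | t < |f x|} ≤ M :=
      le_iSup (fun t : Set.Ioi (0 : ℝ) =>
        ENNReal.ofReal ((t : ℝ) ^ (s * q)) * ν {x | (t : ℝ) < |f x|}) ⟨t, ht⟩
    calc ν {x | t < |f x|}
        = (ENNReal.ofReal (t ^ (s * q)) * ν {x | t < |f x|}) * ENNReal.ofReal (t ^ (-(s * q))) := by
          rw [mul_right_comm, ← ENNReal.ofReal_mul (by positivity), ← Real.rpow_add ht]
          simp
      _ ≤ _ := by gcongr
  have hρ0 : (0 : ℝ) ≤ (2 : ℝ) ^ (s * (1 - q)) := by positivity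
  have hρ1 : (2 : ℝ) ^ (s * (1 - q)) < 1 :=
    Real.rpow_lt_one_of_one_lt_of_neg one_lt_two (mul_neg_of_pos_of_neg hs (by linarith))
  set K : ENNReal := ∑' k : ℕ, ENNReal.ofReal (2 ^ s * ((2 : ℝ) ^ (s * (1 - q))) ^ k)
  have hK : K ≠ ⊤ := ((summable_geometric_of_lt_one hρ0 hρ1).mul_left _).tsum_ofReal_ne_top
  have hC : 1 + M * K ≠ ⊤ :=
    ENNReal.add_ne_top.2 ⟨ENNReal.one_ne_top, ENNReal.mul_ne_top hfM.ne hK⟩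
  refine ⟨(1 + M * K).toNNReal, fun E hE => ?_⟩
  rw [ENNReal.coe_toNNReal hC]
  by_cases hE0 : ν E = 0
  · rw [Measure.restrict_eq_zero.2 hE0]
    simp
  set a : ℝ := (ν E).toReal
  have hEa : ν E = ENNReal.ofReal a := (ENNReal.ofReal_toReal (measure_ne_top ν E)).symm
  have ha : 0 < a := ENNReal.toReal_pos hE0 (measure_ne_top ν E)
  -- the height at which the two bounds for the distribution function on `E` balance
  set l : ℝ := a ^ (-(1 / (s * q)))
  have hsq : 0 < s * q := mul_pos hs (by linarith)
  have hl : 0 < l := by positivity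
  have key := lintegral_rpow_abs_le (ν := ν.restrict E) (f := fun x => f x / l)
    (hfm.restrict.div_const l) hs.le
  have h2 : ∀ k : ℕ, ENNReal.ofReal ((2 ^ (k + 1) : ℝ) ^ s) *
      (ν.restrict E) {x | (2 : ℝ) ^ k < |f x / l|} ≤
      (M * ENNReal.ofReal a) * ENNReal.ofReal (2 ^ s * ((2 : ℝ) ^ (s * (1 - q))) ^ k) := by
    intro k
    have hset : {x | (2 : ℝ) ^ k < |f x / l|} = {x | 2 ^ k * l < |f x|} := by
      ext x
      simp only [mem_ofPred_eq, abs_div, abs_of_pos hl, lt_div_iff₀ hl]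
    calc _ ≤ ENNReal.ofReal ((2 ^ (k + 1) : ℝ) ^ s) *
          (M * ENNReal.ofReal ((2 ^ k * l) ^ (-(s * q)))) := by
          gcongr
          rw [hset]
          exact (Measure.restrict_apply_le _ _).trans (hM _ (by positivity))
      _ = M * (ENNReal.ofReal ((2 ^ (k + 1) : ℝ) ^ s) *
          ENNReal.ofReal ((2 ^ k * l) ^ (-(s * q)))) := by ring
      _ = _ := by
          rw [mul_assoc, ← ENNReal.ofReal_mul (by positivity), ← ENNReal.ofReal_mul ha.le]
          congr 2
          rw [Real.mul_rpow (by positivity) hl.le, ← Real.rpow_mul ha.le, ← Real.rpow_natCast,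
            ← Real.rpow_natCast, ← Real.rpow_natCast, ← Real.rpow_mul (by norm_num),
            ← Real.rpow_mul (by norm_num), ← Real.rpow_mul (by norm_num)]
          have e1 : -(1 / (s * q)) * -(s * q) = 1 := by field_simp
          rw [e1, Real.rpow_one, ← mul_assoc, ← Real.rpow_add two_pos, mul_comm a,
            ← Real.rpow_add two_pos]
          congr 2
          push_cast
          ring
  calc ∫⁻ x in E, ENNReal.ofReal (|f x| ^ s) ∂ν
      = ENNReal.ofReal (l ^ s) * ∫⁻ x in E, ENNReal.ofReal (|f x / l| ^ s) ∂ν := by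
        rw [← lintegral_const_mul' _ _ ENNReal.ofReal_ne_top]
        refine lintegral_congr fun x => ?_
        rw [← ENNReal.ofReal_mul (by positivity), ← Real.mul_rpow hl.le (abs_nonneg _), abs_div,
          abs_of_pos hl, mul_div_cancel₀ _ hl.ne']
    _ ≤ ENNReal.ofReal (l ^ s) * (ENNReal.ofReal a + (M * ENNReal.ofReal a) * K) := by
        gcongr
        refine key.trans ?_
        rw [Measure.restrict_apply_univ, hEa]
        gcongr
        rw [← ENNReal.tsum_mul_left]
        exact ENNReal.tsum_le_tsum h2
    _ = (1 + M * K) * (ENNReal.ofReal (l ^ s) * ENNReal.ofReal a) := by ring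
    _ = (1 + M * K) * ν E ^ (1 - 1 / q) := by
        congr 1
        rw [hEa, ENNReal.ofReal_rpow_of_pos ha, ← ENNReal.ofReal_mul (by positivity),
          ← Real.rpow_mul ha.le]
        congr 1
        rw [mul_comm, ← Real.rpow_one_add' ha.le]
        · congr 1
          have : q ≠ 0 := by positivity
          field_simp
          ring
        · have e2 : -(1 / (s * q)) * s = -(1 / q) := by field_simp
          rw [e2]
          have : 1 / q < 1 := (div_lt_one (by positivity)).2 hq
          intro h; linarith

/-! ### A Gagliardo–Nirenberg inequality with weighted partial derivatives -/

/-- The fundamental theorem of calculus along the line through `y` in direction `i`. -/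
theorem enorm_le_lintegral_partialDeriv {N : ℕ} {ψ : EuclideanSpace ℝ (Fin N) → ℝ}
    (hψ : ContDiff ℝ 1 ψ) (hc : HasCompactSupport ψ) (i : Fin N) (y : Fin N → ℝ) :
    ‖ψ (WithLp.toLp 2 y)‖ₑ ≤
      ∫⁻ t : ℝ, ‖partialDeriv i ψ (WithLp.toLp 2 (Function.update y i t))‖ₑ := by
  set e : (Fin N → ℝ) ≃L[ℝ] EuclideanSpace ℝ (Fin N) := (EuclideanSpace.equiv (Fin N) ℝ).symm
  have he : ∀ z, e z = WithLp.toLp 2 z := fun z => rfl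
  have hu : ContDiff ℝ 1 (ψ ∘ e) := hψ.comp e.contDiff
  have hcu : HasCompactSupport (ψ ∘ e) := hc.comp_homeomorph e.toHomeomorph
  have h1 : ContDiff ℝ 1 ((ψ ∘ e) ∘ Function.update y i) :=
    hu.comp (by convert! contDiff_update 1 y i)
  have h2 : HasCompactSupport ((ψ ∘ e) ∘ Function.update y i) :=
    hcu.comp_isClosedEmbedding (isClosedEmbedding_update y i)
  have h3 : ∀ t, deriv ((ψ ∘ e) ∘ Function.update y i) t =
      partialDeriv i ψ (WithLp.toLp 2 (Function.update y i t)) := by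
    intro t
    have hd : HasDerivAt (fun t => e (Function.update y i t)) (e (Pi.single i 1)) t :=
      e.hasFDerivAt.comp_hasDerivAt t (hasDerivAt_update y i t)
    exact ((hψ.differentiable one_ne_zero _).hasFDerivAt.comp_hasDerivAt t hd).deriv
  calc ‖ψ (WithLp.toLp 2 y)‖ₑ = ‖((ψ ∘ e) ∘ Function.update y i) (y i)‖ₑ := by simp [he]
    _ ≤ ∫⁻ t in Iic (y i), ‖deriv ((ψ ∘ e) ∘ Function.update y i) t‖ₑ :=
        HasCompactSupport.enorm_le_lintegral_Ici_deriv h1 h2 _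
    _ ≤ ∫⁻ t, ‖deriv ((ψ ∘ e) ∘ Function.update y i) t‖ₑ := setLIntegral_le_lintegral _ _
    _ = _ := lintegral_congr fun t => by rw [h3]

/-- Gagliardo–Nirenberg inequality with a separate weight for each partial derivative. The freedom
in `c` replaces the product of the anisotropic norms in the usual form of the inequality. -/
theorem prod_mul_lintegral_rpow_le {N : ℕ} (hN : 2 ≤ N) {ψ : EuclideanSpace ℝ (Fin N) → ℝ}
    (hψ : ContDiff ℝ 1 ψ) (hc : HasCompactSupport ψ) (c : Fin N → ENNReal) :
    (∏ i, c i ^ (1 / (N - 1 : ℝ))) * ∫⁻ x, ‖ψ x‖ₑ ^ (N / (N - 1 : ℝ)) ≤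
      (∫⁻ x, ∑ i, c i * ‖partialDeriv i ψ x‖ₑ) ^ (N / (N - 1 : ℝ)) := by
  have hN' : (2 : ℝ) ≤ N := by exact_mod_cast hN
  have hN1 : (0 : ℝ) < N - 1 := by linarith
  have hp : Real.HolderConjugate (Fintype.card (Fin N)) (N / (N - 1 : ℝ)) := by
    rw [Fintype.card_fin]
    exact Real.HolderConjugate.conjExponent (by linarith)
  have hcont : ∀ i, Continuous (partialDeriv i ψ) := fun i =>
    (hψ.continuous_fderiv one_ne_zero).clm_apply continuous_const
  have hvp := PiLp.volume_preserving_toLp (Fin N)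
  have hmeas : Measurable fun x => ∑ i, c i * ‖partialDeriv i ψ x‖ₑ :=
    Finset.measurable_sum _ fun i _ => (hcont i).measurable.enorm.const_mul _
  have hgrid := lintegral_prod_lintegral_pow_le (fun _ : Fin N => (volume : Measure ℝ)) hp
    (f := fun y => ∑ i, c i * ‖partialDeriv i ψ (WithLp.toLp 2 y)‖ₑ)
    (hmeas.comp hvp.measurable)
  have hpow : Measurable fun x => ‖ψ x‖ₑ ^ (N / (N - 1 : ℝ)) :=
    hψ.continuous.measurable.enorm.pow_const _
  have hpow' : Measurable fun y : Fin N → ℝ => ‖ψ (WithLp.toLp 2 y)‖ₑ ^ (N / (N - 1 : ℝ)) :=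
    hpow.comp hvp.measurable
  rw [← hvp.lintegral_comp hmeas, ← hvp.lintegral_comp hpow,
    ← lintegral_const_mul _ hpow']
  refine le_trans (lintegral_mono fun y => ?_) hgrid
  calc (∏ i, c i ^ (1 / (N - 1 : ℝ))) * ‖ψ (WithLp.toLp 2 y)‖ₑ ^ (N / (N - 1 : ℝ))
      = ∏ i, (c i * ‖ψ (WithLp.toLp 2 y)‖ₑ) ^ (1 / (N - 1 : ℝ)) := by
        simp_rw [ENNReal.mul_rpow_of_nonneg _ _ (one_div_nonneg.2 hN1.le)]
        rw [Finset.prod_mul_distrib, Finset.prod_const, Finset.card_univ, Fintype.card_fin,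
          ← ENNReal.rpow_natCast, ← ENNReal.rpow_mul]
        congr 3
        field_simp
    _ ≤ _ := by
        rw [Fintype.card_fin]
        refine Finset.prod_le_prod' fun i _ => ?_
        gcongr
        calc c i * ‖ψ (WithLp.toLp 2 y)‖ₑ
            ≤ c i * ∫⁻ t : ℝ, ‖partialDeriv i ψ (WithLp.toLp 2 (Function.update y i t))‖ₑ := by
              gcongr
              exact enorm_le_lintegral_partialDeriv hψ hc i y
          _ = ∫⁻ t : ℝ, c i * ‖partialDeriv i ψ (WithLp.toLp 2 (Function.update y i t))‖ₑ := by
              rw [lintegral_const_mul]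
              exact (hcont i).measurable.enorm.comp (hvp.measurable.comp (measurable_update y))
          _ ≤ _ := lintegral_mono fun t => Finset.single_le_sum
              (f := fun j => c j * ‖partialDeriv j ψ (WithLp.toLp 2 (Function.update y i t))‖ₑ)
              (fun _ _ => zero_le) (Finset.mem_univ i)

/-- A smooth cutoff between the heights `1` and `2`, whose derivative vanishes off `1 < |s| ≤ 2`. -/
theorem exists_smooth_level_cutoff : ∃ (η : ℝ → ℝ) (C : ℝ), ContDiff ℝ 1 η ∧ 0 < C ∧
    (∀ s, |s| ≤ 1 → η s = 0) ∧ (∀ s, 2 ≤ |s| → η s = 1) ∧ (∀ s, |deriv η s| ≤ C) ∧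
    ∀ s, ¬ (1 < |s| ∧ |s| ≤ 2) → deriv η s = 0 := by
  have h0 : ∀ s : ℝ, |s| ≤ 1 → Real.smoothTransition (s ^ 2 - 1) = 0 := fun s hs =>
    Real.smoothTransition.zero_of_nonpos (by linarith [(sq_le_one_iff_abs_le_one s).2 hs])
  have h1 : ∀ s : ℝ, 2 ≤ |s| → Real.smoothTransition (s ^ 2 - 1) = 1 := fun s hs =>
    Real.smoothTransition.one_of_one_le (by nlinarith [sq_abs s])
  have hcd : ContDiff ℝ 1 fun s : ℝ => Real.smoothTransition (s ^ 2 - 1) :=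
    Real.smoothTransition.contDiff.comp (by fun_prop)
  have hd : ∀ s : ℝ, ¬ (1 < |s| ∧ |s| ≤ 2) →
      deriv (fun s : ℝ => Real.smoothTransition (s ^ 2 - 1)) s = 0 := by
    intro s hs
    rcases le_or_gt |s| 1 with h | h
    · -- the cutoff is minimal at `s`
      refine IsLocalMin.deriv_eq_zero (Filter.Eventually.of_forall fun t => ?_)
      simp only [h0 s h]
      exact Real.smoothTransition.nonneg _
    · have h2 : 2 ≤ |s| := by
        by_contra! h2
        exact hs ⟨h, h2.le⟩
      -- the cutoff is maximal at `s`
      refine IsLocalMax.deriv_eq_zero (Filter.Eventually.of_forall fun t => ?_)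
      simp only [h1 s h2]
      exact Real.smoothTransition.le_one _
  obtain ⟨C, hC⟩ := (isCompact_Icc (a := (-2 : ℝ)) (b := 2)).exists_bound_of_continuousOn
    (hcd.continuous_deriv le_rfl).continuousOn
  refine ⟨_, max C 1, hcd, by positivity, h0, h1, fun s => ?_, hd⟩
  by_cases hs : 1 < |s| ∧ |s| ≤ 2
  · exact (hC s (abs_le.1 hs.2)).trans (le_max_left _ _)
  · rw [hd s hs, abs_zero]
    positivity

/-- The recursion hidden in `level_inequality`, with `m k` the volume of the `k`-th level set and
`S k` the energy between consecutive levels: the quantities `y k = 2 ^ (k a) m k ^ (1 - a / N)`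
satisfy `y (k + 1) ≤ y k / 2 + D S k`. -/
theorem sum_le_of_level_inequality {a C N : ℝ} (ha : 1 < a) (hN : a < N) (hC : 0 < C) :
    ∃ C' : ℝ, 0 ≤ C' ∧ ∀ (m S : ℕ → ℝ), (∀ k, 0 ≤ m k) → (∀ k, 0 ≤ S k) →
      (∀ K : ℝ, 0 < K → ∀ k, 2 ^ k * K ^ (1 - 1 / a) * m (k + 1) ^ (1 - 1 / N) ≤
        C * (S k + N * K * m k)) →
      ∀ n, ∑ k ∈ Finset.range n, ((2 : ℝ) ^ k) ^ a * m k ^ (1 - a / N) ≤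
        2 * m 0 ^ (1 - a / N) + C' * ∑ k ∈ Finset.range n, S k := by
  have ha0 : 0 < a := by linarith
  have hN0 : 0 < N := by linarith
  have hθ : 0 < 1 - a / N := by rw [sub_pos, div_lt_one hN0]; exact hN
  set θ := 1 - a / N with hθdef
  -- if `m k ≥ R * m (k + 1)`, then `y (k + 1) ≤ y k / 2`
  set R : ℝ := 2 ^ ((a + 1) / θ) with hR
  have hR0 : 0 < R := by positivity
  set L : ℝ := C * N * R + 1 with hL
  have hL0 : 0 < L := by positivity
  set D : ℝ := (2 * L) ^ a * C with hD
  have hD0 : 0 ≤ D := by positivity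
  refine ⟨2 * D, by positivity, fun m S hm hS h n => ?_⟩
  set y : ℕ → ℝ := fun k => ((2 : ℝ) ^ k) ^ a * m k ^ θ with hy
  have hy0 : ∀ k, 0 ≤ y k := fun k => mul_nonneg (by positivity) (Real.rpow_nonneg (hm k) _)
  have step : ∀ k, y (k + 1) ≤ y k / 2 + D * S k := by
    intro k
    have hDS : 0 ≤ D * S k := mul_nonneg hD0 (hS k)
    rcases (hm (k + 1)).eq_or_lt with h0 | hpos
    · have : y (k + 1) = 0 := by simp only [hy, ← h0, Real.zero_rpow hθ.ne', mul_zero]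
      rw [this]
      linarith [hy0 k]
    rcases le_or_gt (R * m (k + 1)) (m k) with hcase | hcase
    · -- the level sets shrink fast: geometric decay
      have hRθ : R ^ θ = 2 ^ (a + 1) := by
        rw [hR, ← Real.rpow_mul two_pos.le, div_mul_cancel₀ _ hθ.ne']
      have h1 : 2 ^ (a + 1) * m (k + 1) ^ θ ≤ m k ^ θ := by
        rw [← hRθ, ← Real.mul_rpow hR0.le hpos.le]
        exact Real.rpow_le_rpow (by positivity) hcase hθ.le
      have h2 : y (k + 1) = ((2 : ℝ) ^ k) ^ a * (2 ^ (a + 1) * m (k + 1) ^ θ) / 2 := by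
        simp only [hy]
        rw [pow_succ, Real.mul_rpow (by positivity) two_pos.le, Real.rpow_add two_pos,
          Real.rpow_one]
        ring
      have h3 : ((2 : ℝ) ^ k) ^ a * (2 ^ (a + 1) * m (k + 1) ^ θ) ≤ y k :=
        mul_le_mul_of_nonneg_left h1 (by positivity)
      rw [h2]
      linarith
    · -- comparable level sets: the volume term is absorbed by a good choice of `K`
      set M := m (k + 1)
      -- `K = Q ^ a` makes the left-hand side of the hypothesis equal to `L * K * M`
      set Q : ℝ := 2 ^ k * M ^ (-(1 / N)) / L with hQ
      have hQ0 : 0 < Q := by positivity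
      have hK := h (Q ^ a) (by positivity) k
      have e1 : 2 ^ k * (Q ^ a) ^ (1 - 1 / a) * M ^ (1 - 1 / N) = L * (Q ^ a * M) := by
        have e2 : (Q ^ a) ^ (1 - 1 / a) * Q = Q ^ a := by
          rw [← Real.rpow_mul hQ0.le]
          nth_rewrite 2 [← Real.rpow_one Q]
          rw [← Real.rpow_add hQ0]
          congr 1
          field_simp
          ring
        have e3 : (2 : ℝ) ^ k * M ^ (1 - 1 / N) = L * Q * M := by
          rw [hQ, mul_div_cancel₀ _ hL0.ne', mul_assoc, ← Real.rpow_add_one hpos.ne']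
          congr 2
          ring
        calc _ = (Q ^ a) ^ (1 - 1 / a) * (2 ^ k * M ^ (1 - 1 / N)) := by ring
          _ = L * (((Q ^ a) ^ (1 - 1 / a) * Q) * M) := by rw [e3]; ring
          _ = _ := by rw [e2]
      have h4 : Q ^ a * M ≤ C * S k := by
        have h5 : C * (N * Q ^ a * m k) ≤ C * (N * Q ^ a * (R * M)) := by gcongr
        rw [e1, hL] at hK
        linarith
      have h6 : y (k + 1) = (2 * L) ^ a * (Q ^ a * M) := by
        have : 2 * L * Q = 2 ^ (k + 1) * M ^ (-(1 / N)) := by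
          rw [hQ, mul_assoc, mul_div_cancel₀ _ hL0.ne', pow_succ]
          ring
        rw [← mul_assoc, ← Real.mul_rpow (by positivity) hQ0.le, this,
          Real.mul_rpow (by positivity) (by positivity), ← Real.rpow_mul hpos.le, mul_assoc,
          ← Real.rpow_add_one hpos.ne']
        simp only [hy]
        congr 2
        rw [hθdef]
        ring
      have h7 : y (k + 1) ≤ D * S k := by
        rw [h6, hD, mul_assoc]
        gcongr
      linarith [hy0 k]
  have hsum : ∀ n, ∑ k ∈ Finset.range n, y (k + 1) ≤
      (∑ k ∈ Finset.range n, y k) / 2 + D * ∑ k ∈ Finset.range n, S k := by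
    intro n
    rw [Finset.sum_div, Finset.mul_sum, ← Finset.sum_add_distrib]
    exact Finset.sum_le_sum fun k _ => step k
  have hy00 : y 0 = m 0 ^ θ := by simp [hy]
  have e := Finset.sum_range_succ' y n
  have e' := Finset.sum_range_succ y n
  have := hsum n
  have := hy0 n
  rw [← hy00]
  linarith

/-! ### Decay of the level sets of a test function -/

section Exponents
variable {N : ℕ} (p : Exponents N)

theorem holderConjugate_pconj (i : Fin N) : Real.HolderConjugate (p i : ℝ) (pconj p i) :=
  Real.HolderConjugate.conjExponent (p i).2

theorem one_div_pbar : 1 / pbar p = (1 / (N : ℝ)) * ∑ i, 1 / (p i : ℝ) := by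
  rw [pbar, one_div, inv_inv]

theorem one_lt_pbar (hN : 0 < N) : 1 < pbar p := by
  have hN' : (0 : ℝ) < N := by exact_mod_cast hN
  have := one_div_pbar p
  have hne : (Finset.univ : Finset (Fin N)).Nonempty := ⟨⟨0, hN⟩, Finset.mem_univ _⟩
  have h1 : ∑ i, 1 / (p i : ℝ) < ∑ i : Fin N, (1 : ℝ) :=
    Finset.sum_lt_sum_of_nonempty hne fun i _ =>
      (div_lt_one (zero_lt_one.trans (p i).2)).2 (p i).2
  have h0 : 0 < ∑ i, 1 / (p i : ℝ) :=
    Finset.sum_pos (fun i _ => one_div_pos.2 (zero_lt_one.trans (p i).2)) hne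
  simp only [Finset.sum_const, Finset.card_univ, Fintype.card_fin, nsmul_eq_mul, mul_one] at h1
  rw [pbar]
  refine (one_lt_inv₀ (by positivity)).2 ?_
  rw [one_div, inv_mul_lt_iff₀ hN']
  linarith

theorem sum_one_div_pconj (hN : 0 < N) : ∑ i, 1 / pconj p i = N * (1 - 1 / pbar p) := by
  have hN' : (0 : ℝ) < N := by exact_mod_cast hN
  have h : ∀ i, 1 / pconj p i = 1 - 1 / (p i : ℝ) := fun i => by
    have := (holderConjugate_pconj p i).inv_add_inv_eq_one
    rw [one_div, one_div]; linarith
  rw [Finset.sum_congr rfl fun i _ => h i, Finset.sum_sub_distrib, one_div_pbar]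
  simp only [Finset.sum_const, Finset.card_univ, Fintype.card_fin, nsmul_eq_mul, mul_one]
  field_simp

end Exponents

/-- The weighted Gagliardo–Nirenberg inequality for a cutoff of `φ` between the heights `2 ^ k` and
`2 ^ (k + 1)`, with the weights `K ^ (1 / p_i')`, for which Young's inequality produces the same
volume term `K` for every `i`. -/
theorem level_inequality {N : ℕ} (hN : 2 ≤ N) (p : Exponents N) :
    ∃ C : ℝ, 0 < C ∧ ∀ φ : EuclideanSpace ℝ (Fin N) → ℝ, ContDiff ℝ 1 φ → HasCompactSupport φ →
      ∀ K : ℝ, 0 < K → ∀ k : ℕ,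
        ENNReal.ofReal (K ^ (1 - 1 / pbar p)) *
            volume {x | (2 : ℝ) ^ (k + 1) < |φ x|} ^ (1 - 1 / N : ℝ) ≤
          ENNReal.ofReal (C / 2 ^ k) *
            ((∫⁻ x in {x | (2 : ℝ) ^ k < |φ x| ∧ |φ x| ≤ (2 : ℝ) ^ (k + 1)},
              ∑ i, ENNReal.ofReal (|partialDeriv i φ x| ^ (p i : ℝ))) +
            ENNReal.ofReal (N * K) * volume {x | (2 : ℝ) ^ k < |φ x|}) := by
  obtain ⟨η, C, hη, hC, hη0, hη1, hηC, hηd⟩ := exists_smooth_level_cutoff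
  refine ⟨C, hC, fun φ hφ hφc K hK k => ?_⟩
  have hN' : (2 : ℝ) ≤ N := by exact_mod_cast hN
  have hN1 : (0 : ℝ) < N - 1 := by linarith
  have h2k : (0 : ℝ) < 2 ^ k := by positivity
  have hφm : Measurable φ := hφ.continuous.measurable
  set D := {x | (2 : ℝ) ^ k < |φ x| ∧ |φ x| ≤ (2 : ℝ) ^ (k + 1)}
  have hD : MeasurableSet D :=
    (measurableSet_lt measurable_const hφm.abs).inter (measurableSet_le hφm.abs measurable_const)
  set ψ : EuclideanSpace ℝ (Fin N) → ℝ := fun x => η (φ x / 2 ^ k)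
  have hψ : ContDiff ℝ 1 ψ := hη.comp (hφ.div_const _)
  have hψc : HasCompactSupport ψ :=
    hφc.comp_left (g := fun s => η (s / 2 ^ k)) (by simpa using hη0 0 (by simp))
  have hψd : ∀ i x, partialDeriv i ψ x = deriv η (φ x / 2 ^ k) * (partialDeriv i φ x / 2 ^ k) := by
    intro i x
    have h1 : HasFDerivAt (fun x => φ x / 2 ^ k) ((2 ^ k : ℝ)⁻¹ • fderiv ℝ φ x) x := by
      simpa [div_eq_inv_mul] using ((hφ.differentiable one_ne_zero x).hasFDerivAt.const_mul
        ((2 ^ k : ℝ)⁻¹))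
    have h2 := ((hη.differentiable one_ne_zero _).hasDerivAt (x := φ x / 2 ^ k)).comp_hasFDerivAt
      x h1
    have h3 : fderiv ℝ ψ x = _ := h2.fderiv
    rw [partialDeriv, h3, partialDeriv, div_eq_inv_mul (fderiv ℝ φ x _)]
    rfl
  have key := prod_mul_lintegral_rpow_le hN hψ hψc fun i => ENNReal.ofReal (K ^ (1 / pconj p i))
  set r : ℝ := N / (N - 1 : ℝ) with hr
  have hr0 : 0 < r := by positivity
  have hr1 : (1 - 1 / N : ℝ) * r = 1 := by rw [hr]; field_simp
  have hleft : (ENNReal.ofReal (K ^ (1 - 1 / pbar p)) *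
      volume {x | (2 : ℝ) ^ (k + 1) < |φ x|} ^ (1 - 1 / N : ℝ)) ^ r ≤
      (∏ i, ENNReal.ofReal (K ^ (1 / pconj p i)) ^ (1 / (N - 1 : ℝ))) * ∫⁻ x, ‖ψ x‖ₑ ^ r := by
    rw [ENNReal.mul_rpow_of_nonneg _ _ hr0.le, ← ENNReal.rpow_mul, hr1, ENNReal.rpow_one]
    refine mul_le_mul' (le_of_eq ?_) ?_
    · have e : ∀ i, ENNReal.ofReal (K ^ (1 / pconj p i)) ^ (1 / (N - 1 : ℝ)) =
          ENNReal.ofReal (K ^ (1 / pconj p i * (1 / (N - 1 : ℝ)))) := fun i => by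
        rw [ENNReal.ofReal_rpow_of_pos (by positivity), ← Real.rpow_mul hK.le]
      rw [Finset.prod_congr rfl fun i _ => e i,
        ← ENNReal.ofReal_prod_of_nonneg (fun i _ => by positivity),
        ← Real.rpow_sum_of_pos hK, ← Finset.sum_mul, sum_one_div_pconj p (by lia),
        ENNReal.ofReal_rpow_of_pos (by positivity), ← Real.rpow_mul hK.le]
      congr 2
      rw [hr]
      ring
    · have hE : MeasurableSet {x | (2 : ℝ) ^ (k + 1) < |φ x|} :=
        measurableSet_lt measurable_const hφm.abs
      rw [← lintegral_indicator_one hE]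
      refine lintegral_mono fun x => ?_
      by_cases hx : (2 : ℝ) ^ (k + 1) < |φ x|
      swap
      · rw [indicator_of_notMem (by exact hx)]
        exact zero_le
      rw [indicator_of_mem (by exact hx)]
      have : ψ x = 1 := hη1 _ (by
        rw [abs_div, abs_of_pos h2k, le_div_iff₀ h2k]
        rw [pow_succ] at hx
        linarith)
      simp [this]
  have hright : ∫⁻ x, ∑ i, ENNReal.ofReal (K ^ (1 / pconj p i)) * ‖partialDeriv i ψ x‖ₑ ≤
      ENNReal.ofReal (C / 2 ^ k) *
        ((∫⁻ x in D, ∑ i, ENNReal.ofReal (|partialDeriv i φ x| ^ (p i : ℝ))) +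
          ENNReal.ofReal (N * K) * volume {x | (2 : ℝ) ^ k < |φ x|}) := by
    have hpt : ∀ x, ∑ i, ENNReal.ofReal (K ^ (1 / pconj p i)) * ‖partialDeriv i ψ x‖ₑ ≤
        D.indicator (fun x => ENNReal.ofReal (C / 2 ^ k) *
          (∑ i, ENNReal.ofReal (|partialDeriv i φ x| ^ (p i : ℝ)) + ENNReal.ofReal (N * K))) x := by
      intro x
      by_cases hx : x ∈ D
      · rw [indicator_of_mem hx]
        have hNK : ENNReal.ofReal (N * K) = ∑ _i : Fin N, ENNReal.ofReal K := by
          simp [ENNReal.ofReal_mul]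
        rw [hNK, ← Finset.sum_add_distrib, Finset.mul_sum]
        refine Finset.sum_le_sum fun i _ => ?_
        have hpq := holderConjugate_pconj p i
        rw [Real.enorm_eq_ofReal_abs, ← ENNReal.ofReal_mul (by positivity),
          ← ENNReal.ofReal_add (by positivity) hK.le, ← ENNReal.ofReal_mul (by positivity)]
        refine ENNReal.ofReal_le_ofReal ?_
        set X := |partialDeriv i φ x| with hX
        have hX0 : 0 ≤ X := abs_nonneg _
        have hY := Real.young_inequality_of_nonneg hX0 (b := K ^ (1 / pconj p i))
          (by positivity) hpq
        have hY' : (K ^ (1 / pconj p i)) ^ pconj p i = K := by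
          rw [← Real.rpow_mul hK.le, one_div, inv_mul_cancel₀ hpq.symm.pos.ne', Real.rpow_one]
        rw [hY'] at hY
        have h3 : X ^ (p i : ℝ) / (p i : ℝ) ≤ X ^ (p i : ℝ) :=
          div_le_self (by positivity) hpq.lt.le
        have h4 : K / pconj p i ≤ K := div_le_self hK.le hpq.symm.lt.le
        have h5 : |partialDeriv i ψ x| ≤ C / 2 ^ k * X := by
          rw [hψd, abs_mul, abs_div, abs_of_pos h2k, ← hX]
          calc _ ≤ C * (X / 2 ^ k) := by gcongr; exact hηC _
            _ = _ := by ring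
        calc K ^ (1 / pconj p i) * |partialDeriv i ψ x|
            ≤ K ^ (1 / pconj p i) * (C / 2 ^ k * X) := by gcongr
          _ = C / 2 ^ k * (X * K ^ (1 / pconj p i)) := by ring
          _ ≤ _ := by gcongr; linarith
      · have h0 : deriv η (φ x / 2 ^ k) = 0 := hηd _ fun h => hx (by
          rw [abs_div, abs_of_pos h2k, lt_div_iff₀ h2k, div_le_iff₀ h2k] at h
          refine ⟨by linarith, ?_⟩
          rw [pow_succ]
          linarith)
        simp [hψd, h0]
    refine (lintegral_mono hpt).trans ?_
    rw [lintegral_indicator hD, lintegral_const_mul' _ _ ENNReal.ofReal_ne_top,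
      lintegral_add_right _ measurable_const, setLIntegral_const]
    gcongr
    exact fun x hx => hx.1
  exact (ENNReal.rpow_le_rpow_iff hr0).1
    (hleft.trans (key.trans (ENNReal.rpow_le_rpow hright hr0.le)))

/-- Anisotropic Sobolev inequality in Lorentz form, for `C¹` functions of compact support. -/
theorem exists_tsum_level_le {N : ℕ} (hN : 2 ≤ N) (p : Exponents N) (hp : pbar p < N) :
    ∃ C : NNReal, ∀ φ : EuclideanSpace ℝ (Fin N) → ℝ, ContDiff ℝ 1 φ → HasCompactSupport φ →
      ∑' k : ℕ, ENNReal.ofReal (((2 : ℝ) ^ k) ^ pbar p) *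
          volume {x | (2 : ℝ) ^ k < |φ x|} ^ (1 - pbar p / N) ≤
        2 * volume (tsupport φ) ^ (1 - pbar p / N) +
          C * ∫⁻ x, ∑ i, ENNReal.ofReal (|partialDeriv i φ x| ^ (p i : ℝ)) := by
  obtain ⟨C, hC, hlev⟩ := level_inequality hN p
  have h1 := one_lt_pbar p (by lia)
  have hN0 : (0 : ℝ) < N := by linarith
  have hθ : 0 < 1 - pbar p / N := by rw [sub_pos, div_lt_one hN0]; exact hp
  have hN1 : (0 : ℝ) < 1 - 1 / N := by
    rw [sub_pos, div_lt_one hN0]; linarith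
  obtain ⟨C', hC', hsum⟩ := sum_le_of_level_inequality h1 hp hC
  refine ⟨C'.toNNReal, fun φ hφ hφc => ?_⟩
  have hφm : Measurable φ := hφ.continuous.measurable
  have hcont : ∀ i, Continuous (partialDeriv i φ) := fun i =>
    (hφ.continuous_fderiv one_ne_zero).clm_apply continuous_const
  have hfin : volume (tsupport φ) ≠ ⊤ := hφc.isCompact.measure_lt_top.ne
  have hsub : ∀ k : ℕ, {x | (2 : ℝ) ^ k < |φ x|} ⊆ tsupport φ := by
    intro k x (hx : (2 : ℝ) ^ k < |φ x|)
    refine subset_tsupport _ fun h0 => ?_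
    rw [h0, abs_zero] at hx
    exact absurd hx (not_lt.2 (by positivity))
  have hmfin : ∀ k : ℕ, volume {x | (2 : ℝ) ^ k < |φ x|} ≠ ⊤ := fun k =>
    ne_top_of_le_ne_top hfin (measure_mono (hsub k))
  set g : EuclideanSpace ℝ (Fin N) → ENNReal :=
    fun x => ∑ i, ENNReal.ofReal (|partialDeriv i φ x| ^ (p i : ℝ)) with hg
  have hgfin : ∫⁻ x, g x ≠ ⊤ := by
    rw [hg, lintegral_finsetSum _ fun i _ => by
      have := (hcont i).measurable
      fun_prop]
    refine ENNReal.sum_ne_top.2 fun i _ => ?_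
    have hp0 : 0 < (p i : ℝ) := zero_lt_one.trans (p i).2
    have hcs : HasCompactSupport fun x => |partialDeriv i φ x| ^ (p i : ℝ) :=
      (hφc.fderiv_apply ℝ (EuclideanSpace.single i (1 : ℝ))).comp_left
        (g := fun t : ℝ => |t| ^ (p i : ℝ)) (by simp [hp0.ne'])
    have hcc : Continuous fun x => |partialDeriv i φ x| ^ (p i : ℝ) :=
      (hcont i).abs.rpow_const fun _ => Or.inr hp0.le
    exact ((hcc.integrable_of_hasCompactSupport hcs).lintegral_lt_top).ne
  set D : ℕ → Set (EuclideanSpace ℝ (Fin N)) := fun k =>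
    {x | (2 : ℝ) ^ k < |φ x| ∧ |φ x| ≤ (2 : ℝ) ^ (k + 1)} with hDdef
  have hD : ∀ k, MeasurableSet (D k) := fun k =>
    (measurableSet_lt measurable_const hφm.abs).inter (measurableSet_le hφm.abs measurable_const)
  have hdisj : Pairwise (Function.onFun Disjoint D) := by
    have : ∀ j k, j < k → Disjoint (D j) (D k) := fun j k hjk =>
      Set.disjoint_left.2 fun x hxj hxk => by
        have : (2 : ℝ) ^ (j + 1) ≤ 2 ^ k := pow_le_pow_right₀ one_le_two hjk
        have h1 := hxj.2
        have h2 := hxk.1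
        linarith
    intro j k hjk
    rcases hjk.lt_or_gt with h | h
    · exact this j k h
    · exact (this k j h).symm
  have hSfin : ∀ k, ∫⁻ x in D k, g x ≠ ⊤ := fun k =>
    ne_top_of_le_ne_top hgfin (setLIntegral_le_lintegral _ _)
  have hSsum : ∀ n, ∑ k ∈ Finset.range n, (∫⁻ x in D k, g x).toReal ≤ (∫⁻ x, g x).toReal := by
    intro n
    rw [← ENNReal.toReal_sum fun k _ => hSfin k]
    refine ENNReal.toReal_mono hgfin ?_
    refine (ENNReal.sum_le_tsum _).trans ?_
    rw [← lintegral_iUnion hD hdisj]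
    exact setLIntegral_le_lintegral _ _
  have hreal := hsum (fun k => (volume {x | (2 : ℝ) ^ k < |φ x|}).toReal)
    (fun k => (∫⁻ x in D k, g x).toReal) (fun _ => ENNReal.toReal_nonneg)
    (fun _ => ENNReal.toReal_nonneg) (by
      intro K hK k
      have h := hlev φ hφ hφc K hK k
      have h' := ENNReal.toReal_mono (ENNReal.mul_ne_top ENNReal.ofReal_ne_top
        (ENNReal.add_ne_top.2 ⟨hSfin k, ENNReal.mul_ne_top ENNReal.ofReal_ne_top (hmfin k)⟩)) h
      rw [ENNReal.toReal_mul, ENNReal.toReal_mul,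
        ENNReal.toReal_add (hSfin k) (ENNReal.mul_ne_top ENNReal.ofReal_ne_top (hmfin k)),
        ENNReal.toReal_mul, ENNReal.toReal_ofReal (by positivity),
        ENNReal.toReal_ofReal (by positivity), ENNReal.toReal_ofReal (by positivity),
        ← ENNReal.toReal_rpow, div_mul_eq_mul_div, le_div_iff₀ (by positivity)] at h'
      linarith)
  refine ENNReal.tsum_le_of_sum_range_le fun n => ?_
  have hterm : ∀ k : ℕ, ENNReal.ofReal (((2 : ℝ) ^ k) ^ pbar p) *
      volume {x | (2 : ℝ) ^ k < |φ x|} ^ (1 - pbar p / N) =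
      ENNReal.ofReal (((2 : ℝ) ^ k) ^ pbar p *
        (volume {x | (2 : ℝ) ^ k < |φ x|}).toReal ^ (1 - pbar p / N)) := fun k => by
    rw [ENNReal.ofReal_mul (by positivity), ← ENNReal.ofReal_rpow_of_nonneg
      ENNReal.toReal_nonneg hθ.le, ENNReal.ofReal_toReal (hmfin k)]
  rw [Finset.sum_congr rfl fun k _ => hterm k,
    ← ENNReal.ofReal_sum_of_nonneg fun k _ => by positivity]
  have hm0 : (volume {x | (2 : ℝ) ^ 0 < |φ x|}).toReal ^ (1 - pbar p / N) ≤
      (volume (tsupport φ)).toReal ^ (1 - pbar p / N) :=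
    Real.rpow_le_rpow ENNReal.toReal_nonneg (ENNReal.toReal_mono hfin (measure_mono (hsub 0))) hθ.le
  have hfinal := (hreal n).trans (add_le_add (mul_le_mul_of_nonneg_left hm0 two_pos.le)
    (mul_le_mul_of_nonneg_left (hSsum n) hC'))
  refine (ENNReal.ofReal_le_ofReal hfinal).trans (le_of_eq ?_)
  rw [ENNReal.ofReal_add (by positivity) (by positivity), ENNReal.ofReal_mul two_pos.le,
    ENNReal.ofReal_mul hC', ENNReal.ofReal_toReal hgfin, ← ENNReal.ofReal_rpow_of_nonneg
      ENNReal.toReal_nonneg hθ.le, ENNReal.ofReal_toReal hfin]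
  simp [ENNReal.ofReal]

/-! ### From level sums to integrals; approximation by test functions -/

theorem lintegral_rpow_abs_eq {X : Type*} [MeasurableSpace X] {ν : Measure X} (g : X → ℝ) {r : ℝ}
    (hr : 0 < r) :
    ∫⁻ x, ENNReal.ofReal (|g x| ^ r) ∂ν = eLpNorm g (ENNReal.ofReal r) ν ^ r := by
  rw [eLpNorm_eq_lintegral_rpow_enorm_toReal (by simpa using hr) ENNReal.ofReal_ne_top,
    ENNReal.toReal_ofReal hr.le, ← ENNReal.rpow_mul, one_div, inv_mul_cancel₀ hr.ne',
    ENNReal.rpow_one]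
  refine lintegral_congr fun x => ?_
  rw [Real.enorm_eq_ofReal_abs, ENNReal.ofReal_rpow_of_nonneg (abs_nonneg _) hr.le]

/-- A bound on the Lorentz-type level sum of `f` controls `∫ V |f| ^ a` for weights `V` in the
associated Marcinkiewicz class. -/
theorem lintegral_weight_mul_rpow_le {X : Type*} [MeasurableSpace X] {ν : Measure X}
    {V : X → ENNReal} (hV : AEMeasurable V ν) {C : NNReal} {θ : ℝ}
    (hVC : ∀ E, MeasurableSet E → ∫⁻ x in E, V x ∂ν ≤ C * ν E ^ θ)
    {f : X → ℝ} (hf : Measurable f) {a : ℝ} (ha : 0 ≤ a) :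
    ∫⁻ x, V x * ENNReal.ofReal (|f x| ^ a) ∂ν ≤ C * ν univ ^ θ + C * ENNReal.ofReal (2 ^ a) *
      ∑' k : ℕ, ENNReal.ofReal (((2 : ℝ) ^ k) ^ a) * ν {x | (2 : ℝ) ^ k < |f x|} ^ θ := by
  have hE : ∀ k : ℕ, MeasurableSet {x | (2 : ℝ) ^ k < |f x|} := fun k =>
    measurableSet_lt measurable_const hf.abs
  -- the layer-cake bound for the measure `V ν`
  have h := lintegral_rpow_abs_le (ν := ν.withDensity V) (f := f) hf.aemeasurable ha
  rw [lintegral_withDensity_eq_lintegral_mul₀ hV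
    (((hf.abs.pow_const a).ennreal_ofReal).aemeasurable)] at h
  refine h.trans (add_le_add ?_ ?_)
  · rw [withDensity_apply _ MeasurableSet.univ]
    exact hVC _ MeasurableSet.univ
  · rw [← ENNReal.tsum_mul_left]
    refine ENNReal.tsum_le_tsum fun k => ?_
    rw [withDensity_apply _ (hE k), pow_succ, Real.mul_rpow (by positivity) two_pos.le,
      ENNReal.ofReal_mul (by positivity)]
    calc _ ≤ ENNReal.ofReal (((2 : ℝ) ^ k) ^ a) * ENNReal.ofReal (2 ^ a) *
          (C * ν {x | (2 : ℝ) ^ k < |f x|} ^ θ) := by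
          gcongr
          exact hVC _ (hE k)
      _ = _ := by ring

/-- A bound on the Lorentz-type level sum of `f` controls the critical Lebesgue norm of `f`. -/
theorem lintegral_rpow_div_le {X : Type*} [MeasurableSpace X] {ν : Measure X}
    {f : X → ℝ} (hf : AEMeasurable f ν) {a θ : ℝ} (ha : 0 ≤ a) (hθ : 0 < θ) (hθ1 : θ ≤ 1)
    {T : ENNReal} (hT : ∑' k : ℕ, ENNReal.ofReal (((2 : ℝ) ^ k) ^ a) *
      ν {x | (2 : ℝ) ^ k < |f x|} ^ θ ≤ T) :
    ∫⁻ x, ENNReal.ofReal (|f x| ^ (a / θ)) ∂ν ≤ ν univ + ENNReal.ofReal (2 ^ (a / θ)) *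
      (T ^ (1 / θ - 1) * T) := by
  refine (lintegral_rpow_abs_le hf (by positivity)).trans (add_le_add le_rfl ?_)
  refine le_trans ?_ (mul_le_mul_right (mul_le_mul_right hT (T ^ (1 / θ - 1))) _)
  rw [← ENNReal.tsum_mul_left, ← ENNReal.tsum_mul_left]
  refine ENNReal.tsum_le_tsum fun k => ?_
  set Y := ENNReal.ofReal (((2 : ℝ) ^ k) ^ a) * ν {x | (2 : ℝ) ^ k < |f x|} ^ θ with hY
  have hYT : Y ≤ T := (ENNReal.le_tsum k).trans hT
  have hθ2 : 0 ≤ 1 / θ - 1 := by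
    rw [sub_nonneg, le_div_iff₀ hθ]
    linarith
  have hY1 : ENNReal.ofReal (((2 : ℝ) ^ k) ^ (a / θ)) * ν {x | (2 : ℝ) ^ k < |f x|} =
      Y ^ (1 / θ) := by
    rw [hY, ENNReal.mul_rpow_of_nonneg _ _ (by positivity), ← ENNReal.rpow_mul,
      mul_one_div_cancel hθ.ne', ENNReal.rpow_one, ENNReal.ofReal_rpow_of_pos (by positivity),
      ← Real.rpow_mul (by positivity), mul_one_div]
  rw [pow_succ, Real.mul_rpow (by positivity) two_pos.le, mul_comm (((2 : ℝ) ^ k) ^ (a / θ)),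
    ENNReal.ofReal_mul (by positivity), mul_assoc, hY1]
  gcongr
  have : Y ^ (1 / θ) = Y ^ (1 / θ - 1) * Y := by
    conv_rhs => rw [← ENNReal.rpow_one Y, ← ENNReal.rpow_mul, one_mul]
    rw [← ENNReal.rpow_add_of_nonneg _ _ hθ2 zero_le_one, sub_add_cancel]
  rw [this]
  gcongr

section Approximation
variable {N : ℕ} {Ω : Opens (EuclideanSpace ℝ (Fin N))} {p : Exponents N}

/-- Test functions already form a linear subspace of `W^{1,p}(Ω)`. -/
theorem span_range_testW1 :
    (Submodule.span ℝ (Set.range (testW1 Ω p)) : Set (W1 Ω p)) = Set.range (testW1 Ω p) := by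
  have hadd : ∀ (i : Fin N) (φ ψ : 𝓓(Ω, ℝ)), partialDeriv i (φ + ψ : 𝓓(Ω, ℝ)) =
      partialDeriv i φ + partialDeriv i ψ := fun i φ ψ => by
    ext x
    have h : fderiv ℝ (φ + ψ : 𝓓(Ω, ℝ)) x = fderiv ℝ φ x + fderiv ℝ ψ x :=
      fderiv_add (φ.contDiff.differentiable (by simp) x) (ψ.contDiff.differentiable (by simp) x)
    simp only [partialDeriv, Pi.add_apply, h]
    rfl
  have hsmul : ∀ (i : Fin N) (c : ℝ) (φ : 𝓓(Ω, ℝ)), partialDeriv i (c • φ : 𝓓(Ω, ℝ)) =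
      c • partialDeriv i φ := fun i c φ => by
    ext x
    have h : fderiv ℝ (c • φ : 𝓓(Ω, ℝ)) x = c • fderiv ℝ φ x :=
      fderiv_const_smul (φ.contDiff.differentiable (by simp) x) c
    simp only [partialDeriv, Pi.smul_apply, h]
    rfl
  let L : 𝓓(Ω, ℝ) →ₗ[ℝ] W1 Ω p :=
    { toFun := testW1 Ω p
      map_add' := fun φ ψ => by
        refine Subtype.ext (Prod.ext rfl (funext fun i => ?_))
        exact (MemLp.toLp_congr (memLp_partialDeriv _ i (φ + ψ))
          ((memLp_partialDeriv _ i φ).add (memLp_partialDeriv _ i ψ))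
          (Filter.Eventually.of_forall fun x => congrFun (hadd i φ ψ) x)).trans
          (MemLp.toLp_add (memLp_partialDeriv _ i φ) (memLp_partialDeriv _ i ψ))
      map_smul' := fun c φ => by
        refine Subtype.ext (Prod.ext rfl (funext fun i => ?_))
        exact (MemLp.toLp_congr (memLp_partialDeriv _ i (c • φ))
          ((memLp_partialDeriv _ i φ).const_smul c)
          (Filter.Eventually.of_forall fun x => congrFun (hsmul i c φ) x)).trans
          (MemLp.toLp_const_smul c (memLp_partialDeriv _ i φ)) }
  have : Set.range (testW1 Ω p) = (LinearMap.range L : Set (W1 Ω p)) := rfl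
  rw [this, Submodule.span_eq]

theorem exists_tendsto_testW1 (u : W0 Ω p) :
    ∃ ψ : ℕ → 𝓓(Ω, ℝ), Filter.Tendsto (fun n => testW1 Ω p (ψ n)) Filter.atTop (nhds u.1) ∧
      ∀ᵐ x ∂(volume.restrict (Ω : Set (EuclideanSpace ℝ (Fin N)))),
        Filter.Tendsto (fun n => ψ n x) Filter.atTop (nhds (val u x)) := by
  have hu : u.1 ∈ closure (Set.range (testW1 Ω p)) := by
    rw [← span_range_testW1]
    exact u.2
  obtain ⟨w, hw, hlim⟩ := mem_closure_iff_seq_limit.1 hu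
  choose ψ hψ using hw
  have hlim' : Filter.Tendsto (fun n => testW1 Ω p (ψ n)) Filter.atTop (nhds u.1) := by
    simpa only [hψ] using hlim
  have h1 : Filter.Tendsto (fun n => (testW1 Ω p (ψ n)).1.1) Filter.atTop (nhds u.1.1.1) :=
    ((continuous_fst.comp continuous_subtype_val).tendsto _).comp hlim'
  obtain ⟨ns, hns, hae⟩ := (tendstoInMeasure_of_tendsto_Lp h1).exists_seq_tendsto_ae
  refine ⟨fun n => ψ (ns n), hlim'.comp hns.tendsto_atTop, ?_⟩
  have hcoe : ∀ᵐ x ∂(volume.restrict (Ω : Set (EuclideanSpace ℝ (Fin N)))), ∀ n,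
      (testW1 Ω p (ψ n)).1.1 x = ψ n x :=
    ae_all_iff.2 fun n => (memLp_testFunction 1 (ψ n)).coeFn_toLp
  filter_upwards [hae, hcoe] with x hx hc
  simp only [hc] at hx
  exact hx

theorem lintegral_rpow_partialDeriv (i : Fin N) (φ : 𝓓(Ω, ℝ)) :
    ∫⁻ x, ENNReal.ofReal (|partialDeriv i φ x| ^ (p i : ℝ)) =
      ENNReal.ofReal (‖(testW1 Ω p φ).1.2 i‖ ^ (p i : ℝ)) := by
  have hp0 : 0 < (p i : ℝ) := zero_lt_one.trans (p i).2
  have hzero : ∀ x ∉ (Ω : Set (EuclideanSpace ℝ (Fin N))), partialDeriv i φ x = 0 := by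
    intro x hx
    have : fderiv ℝ φ x = 0 := by
      by_contra h
      exact hx (φ.tsupport_subset (support_fderiv_subset ℝ h))
    simp [partialDeriv, this]
  have h1 : ∫⁻ x, ENNReal.ofReal (|partialDeriv i φ x| ^ (p i : ℝ)) =
      ∫⁻ x in Ω, ENNReal.ofReal (|partialDeriv i φ x| ^ (p i : ℝ)) := by
    rw [← lintegral_indicator Ω.isOpen.measurableSet]
    refine lintegral_congr fun x => ?_
    by_cases hx : x ∈ (Ω : Set (EuclideanSpace ℝ (Fin N)))
    · rw [indicator_of_mem hx]
    · rw [indicator_of_notMem hx, hzero x hx]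
      simp [hp0.ne']
  have h2 : ‖(testW1 Ω p φ).1.2 i‖ =
      (eLpNorm (partialDeriv i φ) (ENNReal.ofReal (p i : ℝ)) (volume.restrict Ω)).toReal :=
    Lp.norm_toLp _ (memLp_partialDeriv _ i φ)
  rw [h1, lintegral_rpow_abs_eq _ hp0, h2, ← ENNReal.ofReal_rpow_of_nonneg ENNReal.toReal_nonneg
    hp0.le, ENNReal.ofReal_toReal (memLp_partialDeriv _ i φ).eLpNorm_ne_top]

/-- Every `u ∈ W_0^{1,p}(Ω)` is an a.e. limit of test functions with bounded Lorentz-type level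
sums. -/
theorem exists_level_bounded_approximation (hN : 2 ≤ N) (hp : pbar p < N)
    (hΩ : Bornology.IsBounded (Ω : Set (EuclideanSpace ℝ (Fin N)))) (u : W0 Ω p) :
    ∃ (T : NNReal) (ψ : ℕ → 𝓓(Ω, ℝ)),
      (∀ n, ∑' k : ℕ, ENNReal.ofReal (((2 : ℝ) ^ k) ^ pbar p) *
          (volume.restrict Ω) {x | (2 : ℝ) ^ k < |ψ n x|} ^ (1 - pbar p / N) ≤ T) ∧
      ∀ᵐ x ∂(volume.restrict (Ω : Set (EuclideanSpace ℝ (Fin N)))),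
        Filter.Tendsto (fun n => ψ n x) Filter.atTop (nhds (val u x)) := by
  obtain ⟨ψ, hψ, hae⟩ := exists_tendsto_testW1 u
  obtain ⟨C, hC⟩ := exists_tsum_level_le hN p hp
  have h1 := one_lt_pbar p (by lia)
  have hN0 : (0 : ℝ) < N := by linarith
  have hθ : 0 < 1 - pbar p / N := by rw [sub_pos, div_lt_one hN0]; exact hp
  obtain ⟨R, hR⟩ := (Metric.isBounded_range_of_tendsto _ hψ).exists_norm_le
  have hR' : ∀ n, ‖testW1 Ω p (ψ n)‖ ≤ R := fun n => hR _ ⟨n, rfl⟩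
  set T : ENNReal := 2 * volume (Ω : Set (EuclideanSpace ℝ (Fin N))) ^ (1 - pbar p / N) +
    C * ∑ i, ENNReal.ofReal (R ^ (p i : ℝ)) with hT
  have hTfin : T ≠ ⊤ := by
    refine ENNReal.add_ne_top.2 ⟨ENNReal.mul_ne_top (by simp)
      (ENNReal.rpow_ne_top_of_nonneg hθ.le hΩ.measure_lt_top.ne), ENNReal.mul_ne_top (by simp) ?_⟩
    exact ENNReal.sum_ne_top.2 fun i _ => ENNReal.ofReal_ne_top
  refine ⟨T.toNNReal, ψ, fun n => ?_, hae⟩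
  rw [ENNReal.coe_toNNReal hTfin]
  refine le_trans ?_ ((hC (ψ n) ((ψ n).contDiff.of_le (by simp)) (ψ n).hasCompactSupport).trans ?_)
  · refine ENNReal.tsum_le_tsum fun k => ?_
    gcongr
    exact Measure.restrict_le_self
  · rw [hT, lintegral_finsetSum _ fun i _ => by
      have := (continuous_partialDeriv i (ψ n)).measurable
      fun_prop]
    gcongr with i
    · exact (ψ n).tsupport_subset
    · rw [lintegral_rpow_partialDeriv (p := p)]
      have hp0 : 0 < (p i : ℝ) := zero_lt_one.trans (p i).2
      refine ENNReal.ofReal_le_ofReal (Real.rpow_le_rpow (norm_nonneg _) ?_ hp0.le)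
      calc ‖(testW1 Ω p (ψ n)).1.2 i‖ ≤ ‖(testW1 Ω p (ψ n)).1.2‖ := norm_le_pi_norm _ i
        _ ≤ ‖(testW1 Ω p (ψ n)).1‖ := norm_snd_le _
        _ ≤ R := hR' n

end Approximation

/-! ### Integrability of the terms of the equation -/

section Integrability
variable {N : ℕ} {Ω : Opens (EuclideanSpace ℝ (Fin N))} {p : Exponents N}

/-- Superposition of a Carathéodory function with a measurable function. The null sets in the
measurability hypothesis may depend on the second variable, so `g` is approximated by simple
functions. -/
theorem IsCaratheodory.aemeasurable_comp {Y : Type*} [TopologicalSpace Y] [PseudoMetrizableSpace Y]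
    [SecondCountableTopology Y] [MeasurableSpace Y] [BorelSpace Y]
    {f : EuclideanSpace ℝ (Fin N) → Y → ℝ} (hf : IsCaratheodory Ω f)
    {g : EuclideanSpace ℝ (Fin N) → Y} (hg : AEMeasurable g (volume.restrict Ω)) :
    AEMeasurable (fun x => f x (g x)) (volume.restrict Ω) := by
  have hgs := hg.aestronglyMeasurable
  have hsimple : ∀ s : SimpleFunc (EuclideanSpace ℝ (Fin N)) Y,
      AEMeasurable (fun x => f x (s x)) (volume.restrict Ω) := by
    intro s
    have h : (fun x => f x (s x)) =
        fun x => ∑ y ∈ s.range, (s ⁻¹' {y}).indicator (fun x => f x y) x := by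
      ext x
      rw [Finset.sum_eq_single (s x)]
      · rw [indicator_of_mem (by simp)]
      · intro y _ hy
        exact indicator_of_notMem (fun h => hy h.symm) _
      · intro h
        exact absurd (s.mem_range_self x) h
    rw [h]
    exact Finset.aemeasurable_fun_sum _ fun y _ => (hf.1 y).indicator (s.measurableSet_fiber y)
  have hmk := hgs.stronglyMeasurable_mk
  refine aemeasurable_of_tendsto_metrizable_ae Filter.atTop (fun n => hsimple (hmk.approx n)) ?_
  filter_upwards [hf.2, hgs.ae_eq_mk] with x hx hxg
  rw [hxg]
  exact (hx.tendsto _).comp (hmk.tendsto_approx x)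

theorem aemeasurable_val (u : W0 Ω p) : AEMeasurable (val u) (volume.restrict Ω) :=
  (Lp.stronglyMeasurable u.1.1.1).measurable.aemeasurable

theorem memLp_grad (u : W0 Ω p) (i : Fin N) :
    MemLp (fun x => grad u x i) (ENNReal.ofReal (p i : ℝ)) (volume.restrict Ω) :=
  Lp.memLp (u.1.1.2 i)

theorem aemeasurable_grad (u : W0 Ω p) : AEMeasurable (grad u) (volume.restrict Ω) :=
  aemeasurable_pi_lambda _ fun i => (memLp_grad u i).aestronglyMeasurable.aemeasurable

theorem memLp_of_lintegral_rpow {X : Type*} [MeasurableSpace X] {ν : Measure X} {g : X → ℝ}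
    (hg : AEMeasurable g ν) {r : ℝ} (hr : 0 < r)
    (h : ∫⁻ x, ENNReal.ofReal (|g x| ^ r) ∂ν < ⊤) : MemLp g (ENNReal.ofReal r) ν := by
  refine ⟨hg.aestronglyMeasurable, ?_⟩
  rw [lintegral_rpow_abs_eq g hr] at h
  exact (ENNReal.rpow_lt_top_iff_of_pos hr).1 h

theorem MemMarcinkiewicz.exists_weight_le (hp : pbar p < N) (h0 : 0 < pbar p) {i : Fin N}
    {c : EuclideanSpace ℝ (Fin N) → ℝ} [IsFiniteMeasure (volume.restrict (Ω : Set
      (EuclideanSpace ℝ (Fin N))))]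
    (hc : MemMarcinkiewicz c (N * pconj p i / pbar p) (volume.restrict Ω)) :
    ∃ C : NNReal, ∀ E, MeasurableSet E →
      ∫⁻ x in E, ENNReal.ofReal (|c x| ^ pconj p i) ∂(volume.restrict Ω) ≤
        C * (volume.restrict Ω) E ^ (1 - pbar p / N) := by
  have h := MemMarcinkiewicz.exists_setLIntegral_le (holderConjugate_pconj p i).symm.pos
    ((one_lt_div h0).2 hp) (f := c) (ν := volume.restrict Ω)
    (by rwa [show pconj p i * (N / pbar p) = N * pconj p i / pbar p by ring])
  rwa [one_div_div] at h

theorem MemMarcinkiewicz.memLp_pconj (hp : pbar p < N) (h0 : 0 < pbar p) {i : Fin N}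
    {c : EuclideanSpace ℝ (Fin N) → ℝ} [IsFiniteMeasure (volume.restrict (Ω : Set
      (EuclideanSpace ℝ (Fin N))))]
    (hc : MemMarcinkiewicz c (N * pconj p i / pbar p) (volume.restrict Ω)) :
    MemLp c (ENNReal.ofReal (pconj p i)) (volume.restrict Ω) := by
  have hN0 : (0 : ℝ) < N := h0.trans hp
  obtain ⟨C, hC⟩ := hc.exists_weight_le hp h0
  refine memLp_of_lintegral_rpow hc.1 (holderConjugate_pconj p i).symm.pos ?_
  have := hC univ MeasurableSet.univ
  rw [Measure.restrict_univ] at this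
  refine this.trans_lt (ENNReal.mul_lt_top (by simp) ?_)
  exact ENNReal.rpow_lt_top_of_nonneg (by rw [sub_nonneg, div_le_one hN0]; exact hp.le)
    (measure_ne_top _ _)

/-- Critical anisotropic Hardy–Sobolev embedding: `c |u| ^ (p̄ / p_i') ∈ L^{p_i'}` for
`c ∈ L^{N p_i' / p̄, ∞}` and `u ∈ W_0^{1,p}(Ω)`. -/
theorem memLp_weight_mul_rpow_val (hN : 2 ≤ N) (hp : pbar p < N)
    (hΩ : Bornology.IsBounded (Ω : Set (EuclideanSpace ℝ (Fin N)))) {i : Fin N}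
    {c : EuclideanSpace ℝ (Fin N) → ℝ}
    (hc : MemMarcinkiewicz c (N * pconj p i / pbar p) (volume.restrict Ω)) (u : W0 Ω p) :
    MemLp (fun x => c x * |val u x| ^ (pbar p / pconj p i)) (ENNReal.ofReal (pconj p i))
      (volume.restrict Ω) := by
  have h1 := one_lt_pbar p (by lia)
  have h0 : 0 < pbar p := by linarith
  have hN0 : (0 : ℝ) < N := by linarith
  have hθ : 0 < 1 - pbar p / N := by rw [sub_pos, div_lt_one hN0]; exact hp
  have : IsFiniteMeasure (volume.restrict (Ω : Set (EuclideanSpace ℝ (Fin N)))) :=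
    isFiniteMeasure_restrict.2 hΩ.measure_lt_top.ne
  have hq : 0 < pconj p i := (holderConjugate_pconj p i).symm.pos
  obtain ⟨C, hC⟩ := hc.exists_weight_le hp h0
  obtain ⟨T, ψ, hT, hψ⟩ := exists_level_bounded_approximation hN hp hΩ u
  have hV : AEMeasurable (fun x => ENNReal.ofReal (|c x| ^ pconj p i)) (volume.restrict Ω) :=
    (hc.1.abs.pow_const _).ennreal_ofReal
  refine memLp_of_lintegral_rpow (hc.1.mul ((aemeasurable_val u).abs.pow_const _)) hq ?_
  have hpt : ∀ t s : ℝ, ENNReal.ofReal (|t * |s| ^ (pbar p / pconj p i)| ^ pconj p i) =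
      ENNReal.ofReal (|t| ^ pconj p i) * ENNReal.ofReal (|s| ^ pbar p) := fun t s => by
    rw [← ENNReal.ofReal_mul (by positivity), abs_mul, Real.mul_rpow (abs_nonneg _) (abs_nonneg _),
      abs_of_nonneg (Real.rpow_nonneg (abs_nonneg s) _), ← Real.rpow_mul (abs_nonneg s),
      div_mul_cancel₀ _ hq.ne']
  refine (lintegral_congr fun x => hpt (c x) (val u x)).trans_lt ?_
  set B : ENNReal :=
    C * (volume.restrict (Ω : Set (EuclideanSpace ℝ (Fin N)))) univ ^ (1 - pbar p / N) +
    C * ENNReal.ofReal (2 ^ pbar p) * T with hB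
  have hBfin : B < ⊤ := by
    refine ENNReal.add_lt_top.2 ⟨ENNReal.mul_lt_top (by simp)
      (ENNReal.rpow_lt_top_of_nonneg hθ.le (measure_ne_top _ _)), ?_⟩
    exact ENNReal.mul_lt_top (ENNReal.mul_lt_top (by simp) ENNReal.ofReal_lt_top) (by simp)
  refine lt_of_le_of_lt ?_ hBfin
  have hbound : ∀ n, ∫⁻ x in Ω, ENNReal.ofReal (|c x| ^ pconj p i) *
      ENNReal.ofReal (|ψ n x| ^ pbar p) ≤ B := fun n =>
    (lintegral_weight_mul_rpow_le hV hC (ψ n).continuous.measurable h0.le).trans (by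
      rw [hB]; gcongr; exact hT n)
  calc ∫⁻ x in Ω, ENNReal.ofReal (|c x| ^ pconj p i) * ENNReal.ofReal (|val u x| ^ pbar p)
      = ∫⁻ x in Ω, Filter.liminf (fun n => ENNReal.ofReal (|c x| ^ pconj p i) *
          ENNReal.ofReal (|ψ n x| ^ pbar p)) Filter.atTop := by
        refine lintegral_congr_ae ?_
        filter_upwards [hψ] with x hx
        refine (Filter.Tendsto.liminf_eq ?_).symm
        refine ENNReal.Tendsto.const_mul ?_ (Or.inr ENNReal.ofReal_ne_top)
        exact ENNReal.tendsto_ofReal (hx.abs.rpow_const (Or.inr h0.le))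
    _ ≤ Filter.liminf (fun n => ∫⁻ x in Ω, ENNReal.ofReal (|c x| ^ pconj p i) *
          ENNReal.ofReal (|ψ n x| ^ pbar p)) Filter.atTop :=
        lintegral_liminf_le' fun n => hV.mul
          (((ψ n).continuous.measurable.abs.pow_const _).ennreal_ofReal).aemeasurable
    _ ≤ B := Filter.liminf_le_of_le (by isBoundedDefault) fun b hb => by
        obtain ⟨n, hn⟩ := hb.exists
        exact hn.trans (hbound n)

/-- The anisotropic Sobolev embedding `W_0^{1,p}(Ω) ⊆ L^{p̄*}(Ω)`. -/
theorem memLp_val (hN : 2 ≤ N) (hp : pbar p < N)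
    (hΩ : Bornology.IsBounded (Ω : Set (EuclideanSpace ℝ (Fin N)))) (u : W0 Ω p) :
    MemLp (val u) (ENNReal.ofReal (N * pbar p / (N - pbar p))) (volume.restrict Ω) := by
  have h1 := one_lt_pbar p (by lia)
  have h0 : 0 < pbar p := by linarith
  have hN0 : (0 : ℝ) < N := by linarith
  have hNp : 0 < (N : ℝ) - pbar p := by linarith
  have hθ : 0 < 1 - pbar p / N := by rw [sub_pos, div_lt_one hN0]; exact hp
  have hθ1 : 1 - pbar p / N ≤ 1 := by
    rw [sub_le_self_iff]
    positivity
  have : IsFiniteMeasure (volume.restrict (Ω : Set (EuclideanSpace ℝ (Fin N)))) :=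
    isFiniteMeasure_restrict.2 hΩ.measure_lt_top.ne
  obtain ⟨T, ψ, hT, hψ⟩ := exists_level_bounded_approximation hN hp hΩ u
  have hr : (N : ℝ) * pbar p / (N - pbar p) = pbar p / (1 - pbar p / N) := by
    field_simp
  rw [hr]
  set r := pbar p / (1 - pbar p / N)
  have hr0 : 0 < r := by positivity
  refine memLp_of_lintegral_rpow (aemeasurable_val u) hr0 ?_
  set B : ENNReal := (volume.restrict (Ω : Set (EuclideanSpace ℝ (Fin N)))) univ +
    ENNReal.ofReal (2 ^ r) *
    ((T : ENNReal) ^ (1 / (1 - pbar p / N) - 1) * T) with hB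
  have hBfin : B < ⊤ := by
    refine ENNReal.add_lt_top.2 ⟨measure_lt_top _ _, ENNReal.mul_lt_top ENNReal.ofReal_lt_top
      (ENNReal.mul_lt_top (ENNReal.rpow_lt_top_of_nonneg ?_ (by simp)) (by simp))⟩
    rw [sub_nonneg, le_div_iff₀ hθ]
    linarith
  refine lt_of_le_of_lt ?_ hBfin
  have hbound : ∀ n, ∫⁻ x in Ω, ENNReal.ofReal (|ψ n x| ^ r) ≤ B := fun n =>
    lintegral_rpow_div_le (ψ n).continuous.measurable.aemeasurable h0.le hθ hθ1 (hT n)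
  calc ∫⁻ x in Ω, ENNReal.ofReal (|val u x| ^ r)
      = ∫⁻ x in Ω, Filter.liminf (fun n => ENNReal.ofReal (|ψ n x| ^ r)) Filter.atTop := by
        refine lintegral_congr_ae ?_
        filter_upwards [hψ] with x hx
        refine (Filter.Tendsto.liminf_eq ?_).symm
        exact ENNReal.tendsto_ofReal (hx.abs.rpow_const (Or.inr hr0.le))
    _ ≤ Filter.liminf (fun n => ∫⁻ x in Ω, ENNReal.ofReal (|ψ n x| ^ r)) Filter.atTop :=
        lintegral_liminf_le' fun n =>
          (((ψ n).continuous.measurable.abs.pow_const _).ennreal_ofReal).aemeasurable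
    _ ≤ B := Filter.liminf_le_of_le (by isBoundedDefault) fun b hb => by
        obtain ⟨n, hn⟩ := hb.exists
        exact hn.trans (hbound n)

theorem PrincipalAssumption.memLp {α : ℝ} {β : Fin N → ℝ}
    {A : Fin N → EuclideanSpace ℝ (Fin N) → (Fin N → ℝ) → ℝ}
    (hA : PrincipalAssumption Ω p α β A) (u : W0 Ω p) (i : Fin N) :
    MemLp (fun x => A i x (grad u x)) (ENNReal.ofReal (pconj p i)) (volume.restrict Ω) := by
  have hpq := holderConjugate_pconj p i
  have hmem : MemLp (fun x => β i * |grad u x i| ^ ((p i : ℝ) - 1)) (ENNReal.ofReal (pconj p i))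
      (volume.restrict Ω) := by
    refine MemLp.const_mul ?_ _
    have := (memLp_grad u i).norm_rpow_div (ENNReal.ofReal ((p i : ℝ) - 1))
    rw [ENNReal.toReal_ofReal (by linarith [hpq.lt]),
      ← ENNReal.ofReal_div_of_pos (by linarith [hpq.lt])] at this
    exact this
  refine hmem.of_le ((hA.caratheodory i).aemeasurable_comp
    (aemeasurable_grad u)).aestronglyMeasurable ?_
  filter_upwards [hA.growth i] with x hx
  exact (hx _).trans (le_abs_self _)

theorem ConvectionAssumption.memLp (hN : 2 ≤ N) (hp : pbar p < N)
    (hΩ : Bornology.IsBounded (Ω : Set (EuclideanSpace ℝ (Fin N))))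
    {b : Fin N → EuclideanSpace ℝ (Fin N) → ℝ} {B : Fin N → EuclideanSpace ℝ (Fin N) → ℝ → ℝ}
    (hB : ConvectionAssumption Ω p b B) (u : W0 Ω p) (i : Fin N) :
    MemLp (fun x => B i x (val u x)) (ENNReal.ofReal (pconj p i)) (volume.restrict Ω) := by
  refine (memLp_weight_mul_rpow_val hN hp hΩ (hB.b_mem i) u).of_le
    ((hB.caratheodory i).aemeasurable_comp (aemeasurable_val u)).aestronglyMeasurable ?_
  filter_upwards [hB.growth i] with x hx
  exact (hx _).trans (le_abs_self _)

theorem ZeroOrderAssumption.integrable (hN : 2 ≤ N) (hp : pbar p < N) (hp2 : ∀ i, (p i : ℝ) ≤ 2)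
    (hΩ : Bornology.IsBounded (Ω : Set (EuclideanSpace ℝ (Fin N)))) {μ γ : ℝ}
    {G : EuclideanSpace ℝ (Fin N) → ℝ → ℝ} (hG : ZeroOrderAssumption Ω p μ γ G) (u : W0 Ω p) :
    Integrable (fun x => G x (val u x)) (volume.restrict Ω) := by
  have : IsFiniteMeasure (volume.restrict (Ω : Set (EuclideanSpace ℝ (Fin N)))) :=
    isFiniteMeasure_restrict.2 hΩ.measure_lt_top.ne
  have hγ := hG.one_le_γ
  have hγr : γ ≤ N * pbar p / (N - pbar p) := by
    have h := hG.γ_lt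
    have hne : Nonempty (Fin N) := ⟨⟨0, by lia⟩⟩
    have hsup : ⨆ i, (p i : ℝ) ≤ 2 := ciSup_le hp2
    rw [pinfty] at h
    -- as all `p i ≤ 2 ≤ γ + 1`, the maximum defining `p_∞` is the Sobolev exponent
    rcases max_cases ((N : ℝ) * pbar p / (N - pbar p)) (⨆ i, (p i : ℝ)) with h' | h' <;> linarith
  have hmem : MemLp (val u) (ENNReal.ofReal γ) (volume.restrict Ω) :=
    (memLp_val hN hp hΩ u).mono_exponent (ENNReal.ofReal_le_ofReal hγr)
  have hint : Integrable (fun x => μ * |val u x| ^ γ) (volume.restrict Ω) := by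
    have := hmem.integrable_norm_rpow (by simpa using by linarith) ENNReal.ofReal_ne_top
    rw [ENNReal.toReal_ofReal (by linarith)] at this
    exact this.const_mul μ
  refine hint.mono' (hG.caratheodory.aemeasurable_comp (aemeasurable_val u)).aestronglyMeasurable ?_
  filter_upwards [hG.growth] with x hx
  exact hx _

end Integrability

/-! ### Nonlinear test functions -/

/-- `∫ H κ_n D_n → ∫ H κ' d` if `H ∈ L^s`, `D_n → d` in the dual space `L^r`, and the `κ_n` are
uniformly bounded and converge a.e. -/
theorem tendsto_integral_mul_mul {X : Type*} [MeasurableSpace X] {ν : Measure X} {r s : ℝ}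
    (hrs : Real.HolderConjugate r s) {H d : X → ℝ} {D κ : ℕ → X → ℝ} {κ' : X → ℝ} {M : ℝ}
    (hH : MemLp H (ENNReal.ofReal s) ν) (hd : MemLp d (ENNReal.ofReal r) ν)
    (hD : ∀ n, MemLp (D n) (ENNReal.ofReal r) ν)
    (hDd : Filter.Tendsto (fun n => eLpNorm (D n - d) (ENNReal.ofReal r) ν) Filter.atTop (nhds 0))
    (hκm : ∀ n, AEStronglyMeasurable (κ n) ν) (hM : ∀ n x, |κ n x| ≤ M)
    (hκ : ∀ᵐ x ∂ν, Filter.Tendsto (fun n => κ n x) Filter.atTop (nhds (κ' x))) :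
    Filter.Tendsto (fun n => ∫ x, H x * (κ n x * D n x) ∂ν) Filter.atTop
      (nhds (∫ x, H x * (κ' x * d x) ∂ν)) := by
  have := hrs.ennrealOfReal
  have := this.symm
  have hb : ∀ n {f : X → ℝ}, MemLp f (ENNReal.ofReal r) ν →
      Integrable (fun x => H x * (κ n x * f x)) ν := fun n f hf => by
    refine MemLp.integrable_mul (p := ENNReal.ofReal s) (q := ENNReal.ofReal r) hH ?_
    refine (hf.const_mul M).of_le ((hκm n).mul hf.aestronglyMeasurable)
      (Filter.Eventually.of_forall fun x => ?_)
    rw [norm_mul, norm_mul]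
    gcongr
    exact (hM n x).trans (le_abs_self _)
  have h1 : Filter.Tendsto (fun n => ∫ x, H x * (κ n x * d x) ∂ν) Filter.atTop
      (nhds (∫ x, H x * (κ' x * d x) ∂ν)) := by
    have hHd : Integrable (fun x => H x * d x) ν := MemLp.integrable_mul hH hd
    refine tendsto_integral_of_dominated_convergence (fun x => M * |H x * d x|)
      (fun n => (hb n hd).aestronglyMeasurable) (hHd.abs.const_mul M)
      (fun n => Filter.Eventually.of_forall fun x => ?_) ?_
    · rw [Real.norm_eq_abs, show H x * (κ n x * d x) = κ n x * (H x * d x) by ring, abs_mul]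
      gcongr
      exact hM n x
    · filter_upwards [hκ] with x hx
      exact (hx.mul_const _).const_mul _
  have h2 : Filter.Tendsto (fun n => ∫ x, H x * (κ n x * (D n - d) x) ∂ν) Filter.atTop
      (nhds 0) := by
    have hle : ∀ n, ‖∫ x, H x * (κ n x * (D n - d) x) ∂ν‖ₑ ≤
        ENNReal.ofReal M * eLpNorm H (ENNReal.ofReal s) ν *
          eLpNorm (D n - d) (ENNReal.ofReal r) ν := by
      intro n
      have hsm := ((hD n).sub hd).aestronglyMeasurable
      calc ‖∫ x, H x * (κ n x * (D n - d) x) ∂ν‖ₑ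
          ≤ ∫⁻ x, ‖H x * (κ n x * (D n - d) x)‖ₑ ∂ν := enorm_integral_le_lintegral_enorm _
        _ ≤ ∫⁻ x, ENNReal.ofReal M * ‖(H • (D n - d)) x‖ₑ ∂ν := by
            refine lintegral_mono fun x => ?_
            have : H x * (κ n x * (D n - d) x) = κ n x * (H • (D n - d)) x := by
              simp only [Pi.smul_apply', smul_eq_mul]
              ring
            rw [this, enorm_mul]
            gcongr
            rw [Real.enorm_eq_ofReal_abs]
            exact ENNReal.ofReal_le_ofReal (hM n x)
        _ = ENNReal.ofReal M * eLpNorm (H • (D n - d)) 1 ν := by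
            rw [lintegral_const_mul' _ _ ENNReal.ofReal_ne_top, eLpNorm_one_eq_lintegral_enorm]
        _ ≤ _ := by
            rw [mul_assoc]
            gcongr
            exact eLpNorm_smul_le_mul_eLpNorm hsm hH.aestronglyMeasurable
    rw [tendsto_zero_iff_enorm_tendsto_zero]
    refine tendsto_of_tendsto_of_tendsto_of_le_of_le tendsto_const_nhds ?_ (fun _ => zero_le) hle
    have := ENNReal.Tendsto.const_mul (a := ENNReal.ofReal M * eLpNorm H (ENNReal.ofReal s) ν) hDd
      (Or.inr (ENNReal.mul_ne_top ENNReal.ofReal_ne_top hH.eLpNorm_ne_top))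
    rwa [mul_zero] at this
  have h3 := h2.add h1
  rw [zero_add] at h3
  refine h3.congr fun n => ?_
  rw [← integral_add (hb n ((hD n).sub hd)) (hb n hd)]
  refine integral_congr_ae (Filter.Eventually.of_forall fun x => ?_)
  simp only [Pi.sub_apply]
  ring

section Testing
variable {N : ℕ} {Ω : Opens (EuclideanSpace ℝ (Fin N))} {p : Exponents N}

/-- The composition `τ ∘ φ` of a test function with a smooth function vanishing at `0`. -/
def compTest (τ : ℝ → ℝ) (hτ : ContDiff ℝ ∞ τ) (h0 : τ 0 = 0) (φ : 𝓓(Ω, ℝ)) : 𝓓(Ω, ℝ) where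
  toFun := fun x => τ (φ x)
  contDiff' := hτ.comp φ.contDiff
  hasCompactSupport' := φ.hasCompactSupport.comp_left h0
  tsupport_subset' := (closure_mono (Function.support_comp_subset h0 φ)).trans φ.tsupport_subset

theorem partialDeriv_compTest {τ : ℝ → ℝ} (hτ : ContDiff ℝ ∞ τ) (h0 : τ 0 = 0) (φ : 𝓓(Ω, ℝ))
    (i : Fin N) (x : EuclideanSpace ℝ (Fin N)) :
    partialDeriv i (compTest τ hτ h0 φ) x = deriv τ (φ x) * partialDeriv i φ x := by
  have h := ((hτ.differentiable (by simp) (φ x)).hasDerivAt).comp_hasFDerivAt x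
    (φ.contDiff.differentiable (by simp) x).hasFDerivAt
  have h' : fderiv ℝ (compTest τ hτ h0 φ) x = deriv τ (φ x) • fderiv ℝ φ x := h.fderiv
  rw [partialDeriv, h', partialDeriv]
  rfl

/-- An equation `-∑ i, ∂_i H_i + g = 0` in the sense of distributions, with `H_i ∈ L^{p_i'}` and
`g ∈ L¹`, may be tested with `τ(w)` for `w ∈ W_0^{1,p}(Ω)` and `τ` smooth and bounded, with bounded
derivative and `τ(0) = 0`. -/
theorem integral_comp_eq_zero {H : Fin N → EuclideanSpace ℝ (Fin N) → ℝ}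
    {g : EuclideanSpace ℝ (Fin N) → ℝ}
    (hH : ∀ i, MemLp (H i) (ENNReal.ofReal (pconj p i)) (volume.restrict Ω))
    (hg : Integrable g (volume.restrict Ω))
    (h : ∀ φ : 𝓓(Ω, ℝ), ∫ x in Ω, ((∑ i, H i x * partialDeriv i φ x) + g x * φ x) = 0)
    (w : W0 Ω p) {τ : ℝ → ℝ} (hτ : ContDiff ℝ ∞ τ) (h0 : τ 0 = 0) {M : ℝ}
    (hM : ∀ s, |τ s| ≤ M) (hM' : ∀ s, |deriv τ s| ≤ M) :
    (∑ i, ∫ x in Ω, H i x * (deriv τ (val w x) * grad w x i)) +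
      ∫ x in Ω, g x * τ (val w x) = 0 := by
  obtain ⟨ψ, hψ, hae⟩ := exists_tendsto_testW1 w
  have hdc : Continuous (deriv τ) := hτ.continuous_deriv (by simp)
  have hz : ∀ n, (∑ i, ∫ x in Ω, H i x * (deriv τ (ψ n x) * partialDeriv i (ψ n) x)) +
      ∫ x in Ω, g x * τ (ψ n x) = 0 := by
    intro n
    set φ := compTest τ hτ h0 (ψ n)
    have hpd : ∀ i x, deriv τ (ψ n x) * partialDeriv i (ψ n) x = partialDeriv i φ x := fun i x =>
      (partialDeriv_compTest hτ h0 (ψ n) i x).symm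
    simp only [hpd]
    have hi1 : ∀ i, Integrable (fun x => H i x * partialDeriv i φ x) (volume.restrict Ω) := fun i =>
      have := (holderConjugate_pconj p i).ennrealOfReal.symm
      MemLp.integrable_mul (hH i) (memLp_partialDeriv (ENNReal.ofReal (p i : ℝ)) i φ)
    have hi2 : Integrable (fun x => g x * φ x) (volume.restrict Ω) :=
      integrable_mul_testFunction le_rfl (memLp_one_iff_integrable.2 hg) φ.continuous
        φ.hasCompactSupport
    have := h φ
    rw [integral_add (integrable_finsetSum _ fun i _ => hi1 i) hi2,
      integral_finsetSum _ fun i _ => hi1 i] at this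
    exact this
  have hconst : Filter.Tendsto (fun n =>
      (∑ i, ∫ x in Ω, H i x * (deriv τ (ψ n x) * partialDeriv i (ψ n) x)) +
        ∫ x in Ω, g x * τ (ψ n x)) Filter.atTop (nhds 0) := by
    simp only [hz]
    exact tendsto_const_nhds
  refine tendsto_nhds_unique (Filter.Tendsto.add (tendsto_finsetSum _ fun i _ => ?_) ?_) hconst
  · refine tendsto_integral_mul_mul (holderConjugate_pconj p i) (hH i) (memLp_grad w i)
      (fun n => memLp_partialDeriv _ i (ψ n)) ?_
      (fun n => (hdc.comp (ψ n).continuous).aestronglyMeasurable) (fun n x => hM' _) ?_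
    · have h1 : Filter.Tendsto (fun n => (testW1 Ω p (ψ n)).1.2 i) Filter.atTop
          (nhds (w.1.1.2 i)) :=
        ((((continuous_apply i).comp continuous_snd).comp continuous_subtype_val).tendsto _).comp hψ
      rw [Lp.tendsto_Lp_iff_tendsto_eLpNorm'] at h1
      refine h1.congr fun n => eLpNorm_congr_ae ?_
      filter_upwards [(memLp_partialDeriv (ENNReal.ofReal (p i : ℝ)) i (ψ n)).coeFn_toLp] with x hx
      exact congrArg (· - grad w x i) hx
    · filter_upwards [hae] with x hx
      exact (hdc.tendsto _).comp hx
  · refine tendsto_integral_of_dominated_convergence (fun x => M * |g x|)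
      (fun n => hg.aestronglyMeasurable.mul
        (hτ.continuous.comp (ψ n).continuous).aestronglyMeasurable) (hg.abs.const_mul M)
      (fun n => Filter.Eventually.of_forall fun x => ?_) ?_
    · rw [norm_mul, mul_comm]
      exact mul_le_mul_of_nonneg_right (hM _) (abs_nonneg _)
    · filter_upwards [hae] with x hx
      exact ((hτ.continuous.tendsto _).comp hx).const_mul _

/-- An element of `W_0^{1,p}(Ω)` is determined by its values, as weak gradients are unique. -/
theorem eq_zero_of_val_ae_eq_zero (w : W0 Ω p)
    (h : ∀ᵐ x ∂(volume.restrict (Ω : Set (EuclideanSpace ℝ (Fin N)))), val w x = 0) : w = 0 := by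
  have h1 : w.1.1.1 = 0 := (Lp.eq_zero_iff_ae_eq_zero).2 h
  have h2 : w.1.1.2 = 0 := by
    funext i
    refine (Lp.eq_zero_iff_ae_eq_zero).2 ?_
    have hloc : LocallyIntegrableOn (w.1.1.2 i) (Ω : Set (EuclideanSpace ℝ (Fin N))) volume := by
      rw [locallyIntegrableOn_iff Ω.isOpen.isLocallyClosed]
      intro k hk hkc
      have hm : MemLp (w.1.1.2 i) (ENNReal.ofReal (p i : ℝ)) (volume.restrict k) :=
        (Lp.memLp (w.1.1.2 i)).mono_measure (Measure.restrict_mono hk le_rfl)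
      have : IsFiniteMeasure (volume.restrict k) := isFiniteMeasure_restrict.2 hkc.measure_lt_top.ne
      exact hm.integrable (factOneLeOfReal (p i)).out
    have hz := Ω.isOpen.ae_eq_zero_of_integral_contDiff_smul_eq_zero hloc (by
      intro φ hφ hφc hφs
      have hw : ∫ x in Ω, val w x * partialDeriv i φ x = - ∫ x in Ω, grad w x i * φ x :=
        w.1.2 i ⟨φ, hφ, hφc, hφs⟩
      have hleft : ∫ x in Ω, val w x * partialDeriv i φ x = 0 := by
        refine integral_eq_zero_of_ae ?_
        filter_upwards [h] with x hx
        simp [hx]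
      rw [hleft, zero_eq_neg] at hw
      rw [← setIntegral_eq_integral_of_forall_compl_eq_zero (s := (Ω : Set _)), ← hw]
      · exact integral_congr_ae (Filter.Eventually.of_forall fun x => mul_comm _ _)
      · intro x hx
        rw [image_eq_zero_of_notMem_tsupport fun h' => hx (hφs h'), zero_smul])
    exact (ae_restrict_iff' Ω.isOpen.measurableSet).2 hz
  exact Subtype.ext (Subtype.ext (Prod.ext h1 h2))

end Testing

/-! ### Uniqueness -/

/-- Young's inequality in the form that absorbs the convection term into the degenerate quadratic
lower bound of the principal part. -/
theorem mul_le_degenerate_sq_add {a β s X D q : ℝ} (ha : 0 < a) (hX : 0 ≤ X) (hXD : X ≤ D) :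
    β * s * X ≤ a * D ^ (q - 2) * X ^ 2 + 1 / (4 * a) * (s ^ 2 * (β ^ 2 * D ^ (2 - q))) := by
  rcases (hX.trans hXD).eq_or_lt with h0 | hD
  · have hX0 : X = 0 := le_antisymm (hXD.trans h0.ge) hX
    have : 0 ≤ D ^ (2 - q) := Real.rpow_nonneg h0.le _
    rw [hX0]
    simp only [mul_zero, ne_eq, OfNat.ofNat_ne_zero, not_false_eq_true, zero_pow, zero_add]
    positivity
  · set e := D ^ (q - 2)
    have he : 0 < e := Real.rpow_pos_of_pos hD _
    have h2 : D ^ (2 - q) = e⁻¹ := by rw [← Real.rpow_neg hD.le, neg_sub]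
    have h3 : a * e * X ^ 2 + 1 / (4 * a) * (s ^ 2 * (β ^ 2 * e⁻¹)) - β * s * X =
        (2 * (a * e) * X - β * s) ^ 2 / (4 * (a * e)) := by
      field_simp
      ring
    rw [h2, ← sub_nonneg, h3]
    positivity

/-- Young's inequality with the conjugate exponents `q' / 2` and `q / (2 - q)`. -/
theorem sq_mul_rpow_le {q q' : ℝ} (hq : Real.HolderConjugate q q') (hq2 : q ≤ 2) {β D : ℝ}
    (hβ : 0 ≤ β) (hD : 0 ≤ D) : β ^ 2 * D ^ (2 - q) ≤ β ^ q' + D ^ q := by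
  have hq0 := hq.pos
  have hq'0 := hq.symm.pos
  have hsum : 2 / q' + (2 - q) / q = 1 := by
    have := hq.inv_add_inv_eq_one
    rw [sub_div, div_self hq0.ne', div_eq_mul_inv, div_eq_mul_inv]
    linarith
  have hw : 0 ≤ (2 - q) / q := div_nonneg (by linarith) hq0.le
  have hw' : 0 ≤ 2 / q' := by positivity
  have h := Real.geom_mean_le_arith_mean2_weighted hw' hw (Real.rpow_nonneg hβ q')
    (Real.rpow_nonneg hD q) hsum
  rw [← Real.rpow_mul hβ, ← Real.rpow_mul hD, mul_div_cancel₀ _ hq'0.ne',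
    mul_div_cancel₀ _ hq0.ne', Real.rpow_two] at h
  have h1 : 2 / q' * β ^ q' ≤ β ^ q' :=
    mul_le_of_le_one_left (Real.rpow_nonneg hβ _) (by linarith)
  have h2 : (2 - q) / q * D ^ q ≤ D ^ q :=
    mul_le_of_le_one_left (Real.rpow_nonneg hD _) (by linarith)
  linarith

theorem deriv_arctan_div {ε : ℝ} (hε : 0 < ε) (s : ℝ) :
    deriv (fun s => Real.arctan (s / ε)) s = ε / (ε ^ 2 + s ^ 2) := by
  have h := (((hasDerivAt_id s).div_const ε).arctan).deriv
  simp only [id] at h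
  rw [h]
  field_simp

/-- The derivative of `arctan (s / ε)` compensates `|s| ^ (2 κ)`: the latter is at most
`|s|` for `|s| ≤ 1`, as `1 ≤ 2 κ`, and at most `s ^ 2` for `|s| > 1`, as `κ ≤ 1`. -/
theorem kernel_mul_sq_le_one {ε κ s : ℝ} (hε : 0 < ε) (hε1 : ε ≤ 1) (hκ : 1 ≤ 2 * κ)
    (hκ1 : κ ≤ 1) : ε / (ε ^ 2 + s ^ 2) * (|s| ^ κ) ^ 2 ≤ 1 := by
  have hs : (|s| ^ κ) ^ 2 = |s| ^ (2 * κ) := by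
    rw [← Real.rpow_natCast, ← Real.rpow_mul (abs_nonneg s), mul_comm]
    norm_num
  rw [hs, div_mul_eq_mul_div, div_le_one (by positivity)]
  have hsq := sq_abs s
  have h0 := abs_nonneg s
  rcases le_or_gt |s| 1 with h | h
  · have : |s| ^ (2 * κ) ≤ |s| := by
      rcases h0.eq_or_lt with h00 | h00
      · rw [← h00, Real.zero_rpow (by linarith)]
      · calc |s| ^ (2 * κ) ≤ |s| ^ (1 : ℝ) := Real.rpow_le_rpow_of_exponent_ge h00 h hκ
          _ = |s| := Real.rpow_one _
    nlinarith [mul_le_mul_of_nonneg_left this hε.le, sq_nonneg (ε - |s|)]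
  · have : |s| ^ (2 * κ) ≤ |s| ^ 2 := by
      rw [← Real.rpow_two]
      exact Real.rpow_le_rpow_of_exponent_le h.le (by linarith)
    nlinarith [mul_le_mul_of_nonneg_left this hε.le, sq_nonneg ε, sq_nonneg s]

theorem tendsto_kernel_mul_sq {ε : ℕ → ℝ} (hε : Filter.Tendsto ε Filter.atTop (nhds 0)) {κ : ℝ}
    (hκ : 0 < κ) (s : ℝ) : Filter.Tendsto (fun n => ε n / (ε n ^ 2 + s ^ 2) * (|s| ^ κ) ^ 2)
      Filter.atTop (nhds 0) := by
  rcases eq_or_ne s 0 with rfl | hs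
  · simp [Real.zero_rpow hκ.ne']
  · have h := (hε.div ((hε.pow 2).add_const (s ^ 2)) (by positivity)).mul_const ((|s| ^ κ) ^ 2)
    simpa using h

theorem arctan_mul_le_arctan_div_mul {t s ε : ℝ} (hε : 0 < ε) (hε1 : ε ≤ 1)
    (hts : 0 ≤ t * s) : t * Real.arctan s ≤ t * Real.arctan (s / ε) := by
  rcases lt_trichotomy s 0 with h | rfl | h
  · have ht : t ≤ 0 := by
      by_contra! ht
      exact absurd hts (not_le.2 (mul_neg_of_pos_of_neg ht h))
    refine mul_le_mul_of_nonpos_left (Real.arctan_mono ?_) ht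
    rw [div_le_iff₀ hε]
    nlinarith
  · simp
  · have ht : 0 ≤ t := nonneg_of_mul_nonneg_left hts h
    refine mul_le_mul_of_nonneg_left (Real.arctan_mono ?_) ht
    rw [le_div_iff₀ hε]
    nlinarith

theorem pbar_le_two {N : ℕ} (hN : 0 < N) (p : Exponents N) (hp : ∀ i, (p i : ℝ) ≤ 2) :
    pbar p ≤ 2 := by
  have hN' : (0 : ℝ) < N := by exact_mod_cast hN
  have h1 := one_lt_pbar p hN
  have h2 := one_div_pbar p
  have h3 : ∑ _i : Fin N, (1 / 2 : ℝ) ≤ ∑ i, 1 / (p i : ℝ) :=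
    Finset.sum_le_sum fun i _ =>
      one_div_le_one_div_of_le (zero_lt_one.trans (p i).2) (hp i)
  simp only [Finset.sum_const, Finset.card_univ, Fintype.card_fin, nsmul_eq_mul] at h3
  have h4 : 1 / 2 ≤ 1 / pbar p := by
    rw [h2, one_div_mul_eq_div, le_div_iff₀ hN']
    linarith
  exact (one_div_le_one_div two_pos (by linarith)).1 h4

section Uniqueness
variable {N : ℕ} {Ω : Opens (EuclideanSpace ℝ (Fin N))} {p : Exponents N}

/-- The weak formulation of the difference of two solutions. All the terms are integrable, so the
integrals of the two weak formulations may be subtracted. -/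
theorem integral_sub_eq_zero (hN : 2 ≤ N) (hp : pbar p < N) (hp2 : ∀ i, (p i : ℝ) ≤ 2)
    (hΩ : Bornology.IsBounded (Ω : Set (EuclideanSpace ℝ (Fin N))))
    {A : Fin N → EuclideanSpace ℝ (Fin N) → (Fin N → ℝ) → ℝ}
    {B : Fin N → EuclideanSpace ℝ (Fin N) → ℝ → ℝ} {G : EuclideanSpace ℝ (Fin N) → ℝ → ℝ}
    {F : StrongDual ℝ (W0 Ω p)} {α : ℝ} {β : Fin N → ℝ} (hA : PrincipalAssumption Ω p α β A)
    {b : Fin N → EuclideanSpace ℝ (Fin N) → ℝ} (hB : ConvectionAssumption Ω p b B)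
    {μ γ : ℝ} (hG : ZeroOrderAssumption Ω p μ γ G) {u v : W0 Ω p}
    (hu : IsWeakSolution A B G F u) (hv : IsWeakSolution A B G F v) (φ : 𝓓(Ω, ℝ)) :
    ∫ x in Ω, ((∑ i, ((A i x (grad u x) - A i x (grad v x)) +
      (B i x (val u x) - B i x (val v x))) * partialDeriv i φ x) +
      (G x (val u x) - G x (val v x)) * φ x) = 0 := by
  have hint : ∀ z : W0 Ω p, Integrable (fun x =>
      (∑ i, (A i x (grad z x) + B i x (val z x)) * partialDeriv i φ x) +
        G x (val z x) * φ x) (volume.restrict Ω) := fun z => by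
    refine (integrable_finsetSum _ fun i _ => ?_).add
      (integrable_mul_testFunction le_rfl
        (memLp_one_iff_integrable.2 (hG.integrable hN hp hp2 hΩ z)) φ.continuous
        φ.hasCompactSupport)
    have := (holderConjugate_pconj p i).ennrealOfReal.symm
    exact MemLp.integrable_mul ((hA.memLp z i).add (hB.memLp hN hp hΩ z i))
      (memLp_partialDeriv (ENNReal.ofReal (p i : ℝ)) i φ)
  have h := (hu φ).trans (hv φ).symm
  rw [← sub_eq_zero, ← integral_sub (hint u) (hint v)] at h
  rw [← h]
  refine integral_congr_ae (Filter.Eventually.of_forall fun x => ?_)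
  simp only
  rw [add_sub_add_comm, ← Finset.sum_sub_distrib, sub_mul]
  congr 1
  exact Finset.sum_congr rfl fun i _ => by ring

theorem integrable_sq_mul_rpow_grad (hp : pbar p < N) (h0 : 0 < pbar p)
    (hp2 : ∀ i, (p i : ℝ) ≤ 2) [IsFiniteMeasure (volume.restrict (Ω : Set
      (EuclideanSpace ℝ (Fin N))))] {i : Fin N} {c : EuclideanSpace ℝ (Fin N) → ℝ}
    (hc : MemMarcinkiewicz c (N * pconj p i / pbar p) (volume.restrict Ω)) (u v : W0 Ω p) :
    Integrable (fun x => c x ^ 2 * (|grad u x i| + |grad v x i|) ^ (2 - (p i : ℝ)))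
      (volume.restrict Ω) := by
  have hpq := holderConjugate_pconj p i
  have hcL := hc.memLp_pconj hp h0
  have hDL : MemLp (fun x => |grad u x i| + |grad v x i|) (ENNReal.ofReal (p i : ℝ))
      (volume.restrict Ω) := (memLp_grad u i).norm.add (memLp_grad v i).norm
  have hi1 := hcL.integrable_norm_rpow (by simpa using hpq.symm.pos) ENNReal.ofReal_ne_top
  have hi2 := hDL.integrable_norm_rpow (by simpa using hpq.pos) ENNReal.ofReal_ne_top
  rw [ENNReal.toReal_ofReal hpq.symm.pos.le] at hi1
  rw [ENNReal.toReal_ofReal hpq.pos.le] at hi2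
  refine (hi1.add hi2).mono' ((hcL.aestronglyMeasurable.aemeasurable.pow_const 2).mul
    (hDL.aestronglyMeasurable.aemeasurable.pow_const _)).aestronglyMeasurable ?_
  refine Filter.Eventually.of_forall fun x => ?_
  have hD : 0 ≤ |grad u x i| + |grad v x i| := add_nonneg (abs_nonneg _) (abs_nonneg _)
  have h := sq_mul_rpow_le hpq (hp2 i) (abs_nonneg (c x)) hD
  rw [sq_abs] at h
  rw [Real.norm_of_nonneg (mul_nonneg (sq_nonneg _) (Real.rpow_nonneg hD _))]
  simp only [Pi.add_apply, Real.norm_eq_abs]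
  rwa [abs_of_nonneg hD]

variable {H W : Fin N → EuclideanSpace ℝ (Fin N) → ℝ} {g : EuclideanSpace ℝ (Fin N) → ℝ}
  {w : W0 Ω p} {κ : Fin N → ℝ} {c : ℝ}

theorem integrable_mul_arctan_val (hg : Integrable g (volume.restrict Ω)) (ε : ℝ) :
    Integrable (fun x => g x * Real.arctan (val w x / ε)) (volume.restrict Ω) := by
  refine (hg.abs.const_mul (Real.pi / 2)).mono' (hg.aestronglyMeasurable.mul
    (Real.measurable_arctan.comp_aemeasurable
      ((aemeasurable_val w).div_const ε)).aestronglyMeasurable)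
    (Filter.Eventually.of_forall fun x => ?_)
  rw [norm_mul, mul_comm]
  refine mul_le_mul_of_nonneg_right ?_ (norm_nonneg _)
  exact abs_le.2 ⟨(Real.neg_pi_div_two_lt_arctan _).le, (Real.arctan_lt_pi_div_two _).le⟩

theorem aemeasurable_kernel (w : W0 Ω p) (ε : ℝ) :
    AEMeasurable (fun x => ε / (ε ^ 2 + val w x ^ 2)) (volume.restrict Ω) :=
  (((aemeasurable_val w).pow_const 2).const_add _).const_div _

theorem aestronglyMeasurable_kernel_mul (w : W0 Ω p) (ε k : ℝ)
    {f : EuclideanSpace ℝ (Fin N) → ℝ} (hf : AEStronglyMeasurable f (volume.restrict Ω)) :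
    AEStronglyMeasurable (fun x => ε / (ε ^ 2 + val w x ^ 2) * (|val w x| ^ k) ^ 2 * f x)
      (volume.restrict Ω) :=
  ((aemeasurable_kernel w ε).mul
    (((aemeasurable_val w).abs.pow_const _).pow_const 2)).aestronglyMeasurable.mul hf

theorem norm_kernel_mul_le {ε k s f : ℝ} (hε : 0 < ε) (hε1 : ε ≤ 1) (hk : 1 ≤ 2 * k)
    (hk1 : k ≤ 1) (hf : 0 ≤ f) : ‖ε / (ε ^ 2 + s ^ 2) * (|s| ^ k) ^ 2 * f‖ ≤ f := by
  rw [Real.norm_of_nonneg (by positivity)]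
  exact mul_le_of_le_one_left hf (kernel_mul_sq_le_one hε hε1 hk hk1)

/-- Outcome of testing with `arctan (w / ε)`, in terms of pointwise lower bounds for the
products `H_i ∂_i w`. -/
theorem integral_mul_arctan_le
    (hH : ∀ i, MemLp (H i) (ENNReal.ofReal (pconj p i)) (volume.restrict Ω))
    (hg : Integrable g (volume.restrict Ω))
    (h : ∀ φ : 𝓓(Ω, ℝ), ∫ x in Ω, ((∑ i, H i x * partialDeriv i φ x) + g x * φ x) = 0)
    (hW : ∀ i, Integrable (W i) (volume.restrict Ω)) (hW0 : ∀ i x, 0 ≤ W i x)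
    (hκ : ∀ i, 1 ≤ 2 * κ i) (hκ1 : ∀ i, κ i ≤ 1)
    (hHW : ∀ i, ∀ᵐ x ∂(volume.restrict (Ω : Set (EuclideanSpace ℝ (Fin N)))),
      -(c * ((|val w x| ^ κ i) ^ 2 * W i x)) ≤ H i x * grad w x i)
    (hgw : ∀ᵐ x ∂(volume.restrict (Ω : Set (EuclideanSpace ℝ (Fin N)))), 0 ≤ g x * val w x)
    {ε : ℝ} (hε : 0 < ε) (hε1 : ε ≤ 1) :
    ∫ x in Ω, g x * Real.arctan (val w x) ≤
      ∑ i, c * ∫ x in Ω, ε / (ε ^ 2 + val w x ^ 2) * (|val w x| ^ κ i) ^ 2 * W i x := by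
  have hker : ∀ s : ℝ, 0 ≤ ε / (ε ^ 2 + s ^ 2) := fun s => by positivity
  have hε0 : 0 ≤ 1 / ε := by positivity
  have hker' : ∀ s : ℝ, ε / (ε ^ 2 + s ^ 2) ≤ 1 / ε := fun s => by
    rw [div_le_div_iff₀ (by positivity) hε]
    nlinarith [sq_nonneg s]
  have hZ := integral_comp_eq_zero hH hg h w (τ := fun s => Real.arctan (s / ε))
    (M := Real.pi / 2 + 1 / ε)
    (Real.contDiff_arctan.comp (contDiff_id.div_const ε)) (by simp)
    (fun s => (abs_le.2 ⟨(Real.neg_pi_div_two_lt_arctan _).le,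
      (Real.arctan_lt_pi_div_two _).le⟩ : |Real.arctan (s / ε)| ≤ Real.pi / 2).trans
      (le_add_of_nonneg_right hε0))
    (fun s => by
      rw [deriv_arctan_div hε, abs_of_nonneg (hker s)]
      exact (hker' s).trans (le_add_of_nonneg_left Real.pi_div_two_pos.le))
  simp only [deriv_arctan_div hε] at hZ
  -- decreasing `ε` increases the zero order term, so it is bounded below by its value at `ε = 1`
  have hGle : ∫ x in Ω, g x * Real.arctan (val w x) ≤
      ∫ x in Ω, g x * Real.arctan (val w x / ε) := by
    refine integral_mono_ae (by simpa using integrable_mul_arctan_val (w := w) hg 1)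
      (integrable_mul_arctan_val hg ε) ?_
    filter_upwards [hgw] with x hx
    exact arctan_mul_le_arctan_div_mul hε hε1 hx
  have hterm : ∀ i, -(c * ∫ x in Ω, ε / (ε ^ 2 + val w x ^ 2) * (|val w x| ^ κ i) ^ 2 * W i x) ≤
      ∫ x in Ω, H i x * (ε / (ε ^ 2 + val w x ^ 2) * grad w x i) := by
    intro i
    rw [← integral_const_mul, ← integral_neg]
    have hint1 : Integrable (fun x => ε / (ε ^ 2 + val w x ^ 2) * (|val w x| ^ κ i) ^ 2 * W i x)
        (volume.restrict Ω) :=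
      (hW i).mono' (aestronglyMeasurable_kernel_mul w ε (κ i) (hW i).aestronglyMeasurable)
        (Filter.Eventually.of_forall fun x => norm_kernel_mul_le hε hε1 (hκ i) (hκ1 i) (hW0 i x))
    have hmem : MemLp (fun x => ε / (ε ^ 2 + val w x ^ 2) * grad w x i)
        (ENNReal.ofReal (p i : ℝ)) (volume.restrict Ω) := by
      refine ((memLp_grad w i).const_mul (1 / ε)).of_le
        ((aemeasurable_kernel w ε).aestronglyMeasurable.mul (memLp_grad w i).aestronglyMeasurable)
        (Filter.Eventually.of_forall fun x => ?_)
      rw [norm_mul, norm_mul, Real.norm_of_nonneg (hker _), Real.norm_of_nonneg hε0]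
      exact mul_le_mul_of_nonneg_right (hker' _) (norm_nonneg _)
    have hint2 : Integrable (fun x => H i x * (ε / (ε ^ 2 + val w x ^ 2) * grad w x i))
        (volume.restrict Ω) :=
      have := (holderConjugate_pconj p i).ennrealOfReal.symm
      MemLp.integrable_mul (hH i) hmem
    refine integral_mono_ae (hint1.const_mul _).neg hint2 ?_
    filter_upwards [hHW i] with x hx
    have := mul_le_mul_of_nonneg_left hx (hker (val w x))
    calc -(c * (ε / (ε ^ 2 + val w x ^ 2) * (|val w x| ^ κ i) ^ 2 * W i x))
        = ε / (ε ^ 2 + val w x ^ 2) * -(c * ((|val w x| ^ κ i) ^ 2 * W i x)) := by ring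
      _ ≤ ε / (ε ^ 2 + val w x ^ 2) * (H i x * grad w x i) := this
      _ = H i x * (ε / (ε ^ 2 + val w x ^ 2) * grad w x i) := by ring
  have hsum := Finset.sum_le_sum fun i (_ : i ∈ Finset.univ) => hterm i
  rw [Finset.sum_neg_distrib] at hsum
  linarith

theorem mul_arctan_val_ae_eq_zero
    (hH : ∀ i, MemLp (H i) (ENNReal.ofReal (pconj p i)) (volume.restrict Ω))
    (hg : Integrable g (volume.restrict Ω))
    (h : ∀ φ : 𝓓(Ω, ℝ), ∫ x in Ω, ((∑ i, H i x * partialDeriv i φ x) + g x * φ x) = 0)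
    (hW : ∀ i, Integrable (W i) (volume.restrict Ω)) (hW0 : ∀ i x, 0 ≤ W i x)
    (hκ : ∀ i, 1 ≤ 2 * κ i) (hκ1 : ∀ i, κ i ≤ 1)
    (hHW : ∀ i, ∀ᵐ x ∂(volume.restrict (Ω : Set (EuclideanSpace ℝ (Fin N)))),
      -(c * ((|val w x| ^ κ i) ^ 2 * W i x)) ≤ H i x * grad w x i)
    (hgw : ∀ᵐ x ∂(volume.restrict (Ω : Set (EuclideanSpace ℝ (Fin N)))), 0 ≤ g x * val w x) :
    ∀ᵐ x ∂(volume.restrict (Ω : Set (EuclideanSpace ℝ (Fin N)))),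
      g x * Real.arctan (val w x) = 0 := by
  have hone : ∀ n : ℕ, 1 / ((n : ℝ) + 1) ≤ 1 := fun n =>
    (div_le_one n.cast_add_one_pos).2 (le_add_of_nonneg_left n.cast_nonneg)
  have hlim : Filter.Tendsto (fun n : ℕ => ∑ i, c *
      ∫ x in Ω, (1 / ((n : ℝ) + 1)) / ((1 / ((n : ℝ) + 1)) ^ 2 + val w x ^ 2) *
        (|val w x| ^ κ i) ^ 2 * W i x) Filter.atTop (nhds (∑ _i : Fin N, c * 0)) := by
    refine tendsto_finsetSum _ fun i _ => Filter.Tendsto.const_mul _ ?_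
    rw [show (0 : ℝ) = ∫ x in (Ω : Set (EuclideanSpace ℝ (Fin N))), (0 : ℝ) by simp]
    refine tendsto_integral_of_dominated_convergence (W i)
      (fun n => aestronglyMeasurable_kernel_mul w _ (κ i) (hW i).aestronglyMeasurable) (hW i)
      (fun n => Filter.Eventually.of_forall fun x =>
        norm_kernel_mul_le Nat.one_div_pos_of_nat (hone n) (hκ i) (hκ1 i) (hW0 i x))
      (Filter.Eventually.of_forall fun x => ?_)
    have := (tendsto_kernel_mul_sq tendsto_one_div_add_atTop_nhds_zero_nat
      (by linarith [hκ i] : 0 < κ i) (val w x)).mul_const (W i x)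
    rwa [zero_mul] at this
  have hnn : ∀ᵐ x ∂(volume.restrict (Ω : Set (EuclideanSpace ℝ (Fin N)))),
      0 ≤ g x * Real.arctan (val w x) := by
    filter_upwards [hgw] with x hx
    rcases lt_trichotomy (val w x) 0 with h | h | h
    · exact mul_nonneg_of_nonpos_of_nonpos
        (by by_contra! hg0; exact absurd hx (not_le.2 (mul_neg_of_pos_of_neg hg0 h)))
        (Real.arctan_le_zero.2 h.le)
    · rw [h, Real.arctan_zero, mul_zero]
    · exact mul_nonneg (nonneg_of_mul_nonneg_left hx h) (Real.arctan_nonneg.2 h.le)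
  have hle0 : ∫ x in Ω, g x * Real.arctan (val w x) ≤ 0 := by
    have := ge_of_tendsto' hlim fun n => integral_mul_arctan_le hH hg h hW hW0 hκ hκ1 hHW hgw
      Nat.one_div_pos_of_nat (hone n)
    simpa using this
  exact (integral_eq_zero_iff_of_nonneg_ae hnn
    (by simpa using integrable_mul_arctan_val (w := w) hg 1)).1
    (le_antisymm hle0 (integral_nonneg_of_ae hnn))

end Uniqueness

end AnisotropicElliptic
end

open AnisotropicElliptic in
theorem theorem6p1 {N : ℕ} (hN : 2 < N)
    -- a bounded domain with Lipschitz boundary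
    (Ω : TopologicalSpace.Opens (EuclideanSpace ℝ (Fin N)))
    (hΩ_bdd : Bornology.IsBounded (Ω : Set (EuclideanSpace ℝ (Fin N))))
    (hΩ_conn : IsConnected (Ω : Set (EuclideanSpace ℝ (Fin N))))
    (hΩ_lip : AnisotropicElliptic.HasLipschitzBoundary Ω)
    -- exponents `1 < p_i ≤ 2` with `p̄ < N` and `2 min_i (p̄ / p_i') ≥ 1`
    (p : AnisotropicElliptic.Exponents N)
    (hp_le : ∀ i, (p i : ℝ) ≤ 2)
    (hp_bar : AnisotropicElliptic.pbar p < N)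
    (hp_min : 1 ≤ 2 * ⨅ i, AnisotropicElliptic.pbar p / AnisotropicElliptic.pconj p i)
    -- the data of the problem and their structural assumptions
    (A : Fin N → EuclideanSpace ℝ (Fin N) → (Fin N → ℝ) → ℝ)
    (B : Fin N → EuclideanSpace ℝ (Fin N) → ℝ → ℝ)
    (G : EuclideanSpace ℝ (Fin N) → ℝ → ℝ)
    (F : StrongDual ℝ (AnisotropicElliptic.W0 Ω p))
    (α : ℝ) (β : Fin N → ℝ)
    (hA : AnisotropicElliptic.PrincipalAssumption Ω p α β A)
    (b : Fin N → EuclideanSpace ℝ (Fin N) → ℝ)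
    (hB : AnisotropicElliptic.ConvectionAssumption Ω p b B)
    (μ γ : ℝ)
    (hG : AnisotropicElliptic.ZeroOrderAssumption Ω p μ γ G)
    -- `𝒢` is not identically zero and strictly increasing in `s`
    (hG_ne : ¬ ∀ᵐ x ∂(volume.restrict (Ω : Set (EuclideanSpace ℝ (Fin N)))), ∀ s : ℝ, G x s = 0)
    (hG_mono : ∀ᵐ x ∂(volume.restrict (Ω : Set (EuclideanSpace ℝ (Fin N)))), StrictMono (G x))
    -- strong monotonicity of the principal part
    (α' : ℝ) (hα' : 0 < α')
    (hA_strong : ∀ i, ∀ᵐ x ∂(volume.restrict (Ω : Set (EuclideanSpace ℝ (Fin N)))),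
      ∀ ξ ξ' : Fin N → ℝ,
        α' * (|ξ i| + |ξ' i|) ^ ((p i : ℝ) - 2) * |ξ i - ξ' i| ^ 2 ≤
          (A i x ξ - A i x ξ') * (ξ i - ξ' i))
    -- Hölder continuity of the convection terms
    (b' : Fin N → EuclideanSpace ℝ (Fin N) → ℝ)
    (hb'_nonneg : ∀ i, ∀ x ∈ Ω, 0 ≤ b' i x)
    (hb'_mem : ∀ i, AnisotropicElliptic.MemMarcinkiewicz (b' i)
      (N * AnisotropicElliptic.pconj p i / AnisotropicElliptic.pbar p)
      (volume.restrict (Ω : Set (EuclideanSpace ℝ (Fin N)))))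
    (hB_holder : ∀ i, ∀ᵐ x ∂(volume.restrict (Ω : Set (EuclideanSpace ℝ (Fin N)))),
      ∀ s s' : ℝ, |B i x s - B i x s'| ≤
        b' i x * |s - s'| ^ (AnisotropicElliptic.pbar p / AnisotropicElliptic.pconj p i))
    -- a weak solution `u`
    (u : AnisotropicElliptic.W0 Ω p)
    (hu : AnisotropicElliptic.IsWeakSolution A B G F u) :
    ∀ v : AnisotropicElliptic.W0 Ω p, AnisotropicElliptic.IsWeakSolution A B G F v → v = u := by
  intro v hv
  have hN2 : 2 ≤ N := hN.le
  have h1p := one_lt_pbar p (by lia)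
  have hp0 : 0 < pbar p := by linarith
  have hfin : IsFiniteMeasure (volume.restrict (Ω : Set (EuclideanSpace ℝ (Fin N)))) :=
    isFiniteMeasure_restrict.2 hΩ_bdd.measure_lt_top.ne
  have hpq := holderConjugate_pconj p
  have hκ : ∀ i, 1 ≤ 2 * (pbar p / pconj p i) := fun i =>
    hp_min.trans (mul_le_mul_of_nonneg_left (ciInf_le (Set.finite_range _).bddBelow i) two_pos.le)
  have hκ1 : ∀ i, pbar p / pconj p i ≤ 1 := fun i => by
    have h2 := pbar_le_two (by lia) p hp_le
    have h3 : 2 ≤ pconj p i := by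
      have h4 := (hpq i).inv_add_inv_eq_one
      have h5 : (2 : ℝ)⁻¹ ≤ (p i : ℝ)⁻¹ := inv_anti₀ (hpq i).pos (hp_le i)
      exact (inv_le_inv₀ (hpq i).symm.pos two_pos).1 (by linarith)
    exact (div_le_one (hpq i).symm.pos).2 (h2.trans h3)
  have hval : val (u - v) =ᵐ[volume.restrict (Ω : Set (EuclideanSpace ℝ (Fin N)))]
      fun x => val u x - val v x := Lp.coeFn_sub _ _
  have hgrad : ∀ i, (fun x => grad (u - v) x i) =ᵐ[volume.restrict
      (Ω : Set (EuclideanSpace ℝ (Fin N)))] fun x => grad u x i - grad v x i :=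
    fun i => Lp.coeFn_sub _ _
  have hzero := mul_arctan_val_ae_eq_zero (w := u - v) (c := 1 / (4 * α'))
    (fun i => ((hA.memLp u i).sub (hA.memLp v i)).add
      ((hB.memLp hN2 hp_bar hΩ_bdd u i).sub (hB.memLp hN2 hp_bar hΩ_bdd v i)))
    ((hG.integrable hN2 hp_bar hp_le hΩ_bdd u).sub (hG.integrable hN2 hp_bar hp_le hΩ_bdd v))
    (integral_sub_eq_zero hN2 hp_bar hp_le hΩ_bdd hA hB hG hu hv)
    (fun i => integrable_sq_mul_rpow_grad hp_bar hp0 hp_le (hb'_mem i) u v)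
    (fun i x => mul_nonneg (sq_nonneg _)
      (Real.rpow_nonneg (add_nonneg (abs_nonneg _) (abs_nonneg _)) _))
    hκ hκ1 (fun i => ?_) ?_
  · refine (sub_eq_zero.1 (eq_zero_of_val_ae_eq_zero (u - v) ?_)).symm
    filter_upwards [hzero, hG_mono, hval] with x hx hmono hwx
    rcases mul_eq_zero.1 hx with h | h
    · rw [hwx, hmono.injective (sub_eq_zero.1 h), sub_self]
    · exact Real.arctan_eq_zero_iff.1 h
  · filter_upwards [hA_strong i, hB_holder i, hval, hgrad i] with x hAx hBx hwx hgx
    have hA' := hAx (grad u x) (grad v x)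
    have hB' := hBx (val u x) (val v x)
    rw [← hwx] at hB'
    rw [← hgx] at hA'
    have hXD : |grad (u - v) x i| ≤ |grad u x i| + |grad v x i| := by
      rw [hgx]
      exact abs_sub _ _
    -- the convection term is absorbed into the principal part, up to the integrable weight
    have hY := mul_le_degenerate_sq_add (β := b' i x)
      (s := |val (u - v) x| ^ (pbar p / pconj p i)) (q := (p i : ℝ)) hα' (abs_nonneg _) hXD
    have hBw : -(b' i x * |val (u - v) x| ^ (pbar p / pconj p i) * |grad (u - v) x i|) ≤
        (B i x (val u x) - B i x (val v x)) * grad (u - v) x i := by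
      refine le_trans (neg_le_neg ?_) (neg_abs_le _)
      rw [abs_mul]
      exact mul_le_mul_of_nonneg_right hB' (abs_nonneg _)
    simp only [Pi.add_apply, Pi.sub_apply, add_mul]
    linarith
  · filter_upwards [hG_mono, hval] with x hx hwx
    rw [hwx, mul_nonneg_iff]
    rcases le_total (val v x) (val u x) with h | h
    · exact Or.inl ⟨sub_nonneg.2 (hx.monotone h), sub_nonneg.2 h⟩
    · exact Or.inr ⟨sub_nonpos.2 (hx.monotone h), sub_nonpos.2 h⟩
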